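/- Let $Y\subset\mathbb{R}^n$ be a Lebesgue measurable set with $0<\lambda_n(Y)<\infty$, where $\lambda_n$ is $n$-dimensional Lebesgue measure, and let $(X,\mu)$ be a measure-interval with $\mu(X)=\lambda_n(Y)$; that is, $(X,\mu)$ is a finite complete measure space admitting a measure-preserving mapping to $[0,\mu(X)]$ (with Lebesgue measure) which, off null sets, is a bijection with measure-preserving inverse. For an integrable $u:X\to\mathbb{R}^n$, the monotone rearrangement of $u$ on $Y$ is the (almost everywhere unique) integrable function $u^\#:Y\to\mathbb{R}^n$ such that $\mu(u^{-1}(A))=\lambda_n((u^\#)^{-1}(A))$ for every Borel set $A\subset\mathbb{R}^n$ and such that $u^\#=\nabla\psi$ almost everywhere in $Y$ for some proper lower semicontinuous convex function $\psi:\mathbb{R}^n\to\mathbb{R}\cup\{-\infty,+\infty\}$. We say that $u$ has a polar factorisation through $Y$ if there is a measure-preserving mapping $s:(X,\mu)\to(Y,\lambda_n)$ with $u=u^\#\circ s$ almost everywhere. For a function $f$ on a finite measure space and a measurable set $S$ of its domain, say that $f$ is almost injective (respectively almost countable to one) on $S$ if there is a set $U_0\subset S$ such that $S\setminus U_0$ is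 null and $f$ is injective on $U_0$ (respectively $U_0\cap f^{-1}(v)$ is countable for every $v$). Theorem 2. Let $u:X\to\mathbb{R}^n$ be integrable, let $u^\#$ be its monotone rearrangement on $Y$, and suppose that there is a Borel set $B\subset\mathbb{R}^n$ such that (i) the restriction of $u^\#$ to $(u^\#)^{-1}(B)$ is not almost injective on the complement, in $(u^\#)^{-1}(B)$, of its level sets of positive measure; (ii) the restriction of $u$ to $u^{-1}(B)$ is almost countable to one on the complement, in $u^{-1}(B)$, of its level sets of positive measure. Then $u$ does not have a polar factorisation through $Y$. -/

import Mathlib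

open MeasureTheory Set

namespace PolarFactorisation

/-- Lebesgue measure on a (Lebesgue measurable) set `Y`, as a measure on the Borel subsets of the
subspace `Y`. -/
noncomputable def lebesgueOn {E : Type*} [MeasureSpace E] (Y : Set E) : Measure Y :=
  Measure.comap Subtype.val volume

/-- A measure-preserving transformation: a measure-preserving mapping which, off null sets, is a
bijection whose inverse is also measure-preserving. On the target side "measurable" refers to the
completion of `ν` (for Lebesgue measure: to the Lebesgue sets). -/
structure IsMeasurePreservingTransformation {X Z : Type*} [MeasurableSpace X] [MeasurableSpace Z]
    (μ : Measure X) (ν : Measure Z) (τ : X → Z) : Prop where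
  measurePreserving : MeasurePreserving τ μ ν
  exists_bijOn : ∃ (X₀ : Set X) (Z₀ : Set Z), μ X₀ᶜ = 0 ∧ ν Z₀ᶜ = 0 ∧ BijOn τ X₀ Z₀ ∧
    ∀ A ⊆ X₀, MeasurableSet A → NullMeasurableSet (τ '' A) ν ∧ ν (τ '' A) = μ A

/-- A measure-interval: a finite complete measure space that admits a measure-preserving
transformation onto the interval `[0, μ(X)]` with Lebesgue measure. -/
structure IsMeasureInterval {X : Type*} [MeasurableSpace X] (μ : Measure X) : Prop where
  finite : IsFiniteMeasure μ
  complete : μ.IsComplete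
  exists_transformation : ∃ τ : X → Icc (0 : ℝ) (μ.real univ),
    IsMeasurePreservingTransformation μ (lebesgueOn (Icc (0 : ℝ) (μ.real univ))) τ

/-- Two integrable functions, possibly on different measure spaces, are rearrangements of each
other if the preimages of every Borel set have the same measure. -/
structure IsRearrangement {X Z E : Type*} [MeasurableSpace X] [MeasurableSpace Z]
    [NormedAddCommGroup E] [MeasurableSpace E] (μ : Measure X) (ν : Measure Z)
    (f : X → E) (g : Z → E) : Prop where
  integrable_left : Integrable f μ
  integrable_right : Integrable g ν
  measure_preimage_eq : ∀ B : Set E, MeasurableSet B → μ (f ⁻¹' B) = ν (g ⁻¹' B)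

/-- Proper lower semicontinuous convex functions with values in the extended reals (convexity is
convexity of the epigraph). -/
structure IsProperLscConvex {n : ℕ} (ψ : EuclideanSpace ℝ (Fin n) → EReal) : Prop where
  ne_bot : ∀ y, ψ y ≠ ⊥
  exists_ne_top : ∃ y, ψ y ≠ ⊤
  lsc : LowerSemicontinuous ψ
  convex_epigraph : Convex ℝ {p : EuclideanSpace ℝ (Fin n) × ℝ | ψ p.1 ≤ (p.2 : EReal)}

/-- `v` is the gradient at `y` of a function `ψ` (nowhere equal to `-∞`): `ψ` is finite
near `y` and differentiable at `y` with gradient `v`. -/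
def HasExtGradientAt {n : ℕ} (ψ : EuclideanSpace ℝ (Fin n) → EReal)
    (v y : EuclideanSpace ℝ (Fin n)) : Prop :=
  y ∈ interior {z | ψ z ≠ ⊤} ∧ HasGradientAt (fun z => (ψ z).toReal) v y

/-- `v : Y → ℝⁿ` is (a representative of) the monotone rearrangement of `u` on `Y`.
It is a function on `Y`, which carries `n`-dimensional Lebesgue measure. -/
structure IsMonotoneRearrangement {X : Type*} [MeasurableSpace X] (μ : Measure X) {n : ℕ}
    (u : X → EuclideanSpace ℝ (Fin n)) (Y : Set (EuclideanSpace ℝ (Fin n)))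
    (v : Y → EuclideanSpace ℝ (Fin n)) : Prop where
  isRearrangement : IsRearrangement μ (lebesgueOn Y) u v
  exists_potential : ∃ ψ : EuclideanSpace ℝ (Fin n) → EReal, IsProperLscConvex ψ ∧
    ∀ᵐ y ∂(lebesgueOn Y), HasExtGradientAt ψ (v y) (y : EuclideanSpace ℝ (Fin n))

/-- `u` has a polar factorisation through `Y`: `u = v ∘ s` almost everywhere, with `v` the monotone
rearrangement of `u` on `Y` and `s : X → Y` a measure-preserving mapping. -/
def HasPolarFactorisation {X : Type*} [MeasurableSpace X] (μ : Measure X) {n : ℕ}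
    (u : X → EuclideanSpace ℝ (Fin n)) (Y : Set (EuclideanSpace ℝ (Fin n))) : Prop :=
  ∃ v : Y → EuclideanSpace ℝ (Fin n), IsMonotoneRearrangement μ u Y v ∧
    ∃ s : X → Y, MeasurePreserving s μ (lebesgueOn Y) ∧ u =ᵐ[μ] v ∘ s

/-- The restriction of `f` to `S` is almost injective. -/
def AlmostInjectiveOn {U V : Type*} [MeasurableSpace U] (μ : Measure U) (f : U → V)
    (S : Set U) : Prop :=
  ∃ U₀ ⊆ S, μ (S \ U₀) = 0 ∧ InjOn f U₀

/-- The restriction of `f` to `S` is almost countable to one. -/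
def AlmostCountableToOneOn {U V : Type*} [MeasurableSpace U] (μ : Measure U) (f : U → V)
    (S : Set U) : Prop :=
  ∃ U₀ ⊆ S, μ (S \ U₀) = 0 ∧ ∀ v : V, (U₀ ∩ f ⁻¹' {v}).Countable

/-- The complement, in `S`, of the level sets of positive measure of the restriction of `f`
to `S`. -/
def offLargeLevelSets {U V : Type*} [MeasurableSpace U] (μ : Measure U) (f : U → V)
    (S : Set U) : Set U :=
  {x ∈ S | μ (S ∩ f ⁻¹' {f x}) = 0}

end PolarFactorisation

open Filter Topology
open scoped RealInnerProductSpace ENNReal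

/-! The heart is a rigidity of gradients of convex functions: almost countable to one implies almost
injective (`exists_injOn_of_countable_fibres`). The points where a closed convex function has a
given subgradient form a convex set. Let `W x` be the point of least norm in the set belonging to
the gradient `F x`. On the segment from `x` to `W x`, every point of differentiability has gradient
`F x`. If `W x ≠ x` on a set of positive measure, choose a compact subset of it, of positive
measure, and move its points a short way towards `W x`. Volume shrinks by at most `(1 - t) ^ n`
(`exists_contractsAlong_isMinimalPreimage`), so for every small `t` a set of positive measure lands
back in the compact set. Tonelli then yields one segment with uncountably many such times, hence an
uncountable fibre. So `W x = x` almost everywhere, and `F` is injective there, since `W x` depends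
on `F x` alone.

Suppose now that `u = v ∘ σ`. By uniqueness of monotone rearrangements
(`ae_eq_of_hasGradientAt_of_measure_preimage_eq`), `v` and `uSharp` are almost everywhere one
gradient `F`. Fibres of `F` inside the image of `σ` are images of fibres of `u`, hence countable up
to null sets. That the image of `σ` has a measurable part of full measure is where the
measure-interval enters (`IsMeasureInterval.exists_measurableSet_subset_image`). Rigidity then makes
`uSharp` almost injective, a contradiction. -/

namespace PolarFactorisation

/-! ### Subgradients of closed convex functions. -/

section Subgradient

variable {E : Type*} [NormedAddCommGroup E] [InnerProductSpace ℝ E] {s : Set E} {g : E → ℝ}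

/-- A real function on a set `s` which is convex with closed epigraph: the finite part of a lower
semicontinuous convex function with effective domain `s`. -/
structure ClosedConvexOn (s : Set E) (g : E → ℝ) : Prop where
  convexOn : ConvexOn ℝ s g
  isClosed_epigraph : IsClosed {p : E × ℝ | p.1 ∈ s ∧ g p.1 ≤ p.2}

/-- `y` is a subgradient at `x` of the function `g` with effective domain `s`. -/
def IsSubgradientAt (s : Set E) (g : E → ℝ) (y x : E) : Prop :=
  x ∈ s ∧ ∀ z ∈ s, g x + ⟪y, z - x⟫ ≤ g z

theorem _root_.HasGradientAt.isSubgradientAt [CompleteSpace E] (hg : ConvexOn ℝ s g) {x y : E}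
    (hx : x ∈ s) (h : HasGradientAt g y x) : IsSubgradientAt s g y x := by
  refine ⟨hx, fun z hz => ?_⟩
  have hline : ConvexOn ℝ (Icc (0 : ℝ) 1) (fun t : ℝ => g (AffineMap.lineMap x z t)) := by
    refine (hg.comp_affineMap (AffineMap.lineMap x z : ℝ →ᵃ[ℝ] E)).subset ?_ (convex_Icc 0 1)
    intro t ht
    exact hg.1.segment_subset hx hz (by
      rw [segment_eq_image_lineMap]; exact mem_image_of_mem _ ht)
  have hd : HasDerivAt (fun t : ℝ => g (AffineMap.lineMap x z t)) ⟪y, z - x⟫ 0 := by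
    have h1 : HasFDerivAt g (InnerProductSpace.toDual ℝ E y) (AffineMap.lineMap x z (0 : ℝ)) := by
      rw [AffineMap.lineMap_apply_zero]; exact h.hasFDerivAt
    have h2 := h1.comp_hasDerivAt (0 : ℝ) (AffineMap.hasDerivAt_lineMap (a := x) (b := z))
    simpa [Function.comp_def] using h2
  have := hline.le_slope_of_hasDerivAt (x := 0) (y := 1) (by simp) (by simp) one_pos hd
  simp [slope_def_field] at this
  linarith

theorem IsSubgradientAt.eq_of_hasGradientAt [CompleteSpace E] {x y v : E}
    (h : IsSubgradientAt s g y x) (hs : s ∈ 𝓝 x) (hv : HasGradientAt g v x) : y = v := by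
  have hmin : IsLocalMin (fun z => g z - ⟪y, z⟫) x := by
    filter_upwards [hs] with z hz
    have := h.2 z hz
    rw [inner_sub_right] at this
    linarith
  have hd : HasFDerivAt (fun z => g z - ⟪y, z⟫)
      (InnerProductSpace.toDual ℝ E v - InnerProductSpace.toDual ℝ E y) x :=
    hv.hasFDerivAt.sub (InnerProductSpace.toDual ℝ E y).hasFDerivAt
  have h0 := hmin.hasFDerivAt_eq_zero hd
  rw [sub_eq_zero] at h0
  exact ((InnerProductSpace.toDual ℝ E).injective h0).symm

/-- The equality case of monotonicity: the subgradient inequalities between the two points become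
equalities, so the affine minorant touching at `x₁` also touches at `x₂`. -/
theorem IsSubgradientAt.isSubgradientAt_of_inner_le {x₁ x₂ y₁ y₂ : E}
    (h₁ : IsSubgradientAt s g y₁ x₁) (h₂ : IsSubgradientAt s g y₂ x₂)
    (h : ⟪y₁ - y₂, x₁ - x₂⟫ ≤ 0) : IsSubgradientAt s g y₁ x₂ := by
  refine ⟨h₂.1, fun z hz => ?_⟩
  have a := h₁.2 z hz
  have b := h₂.2 x₁ h₁.1
  simp only [inner_sub_left, inner_sub_right] at *
  linarith

theorem IsSubgradientAt.inner_nonneg {x₁ x₂ y₁ y₂ : E}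
    (h₁ : IsSubgradientAt s g y₁ x₁) (h₂ : IsSubgradientAt s g y₂ x₂) :
    0 ≤ ⟪y₁ - y₂, x₁ - x₂⟫ := by
  have a := h₁.2 x₂ h₂.1
  have b := h₂.2 x₁ h₁.1
  simp only [inner_sub_left, inner_sub_right] at *
  linarith

theorem IsSubgradientAt.combo (hg : ConvexOn ℝ s g) {x₁ x₂ y : E}
    (h₁ : IsSubgradientAt s g y x₁) (h₂ : IsSubgradientAt s g y x₂) {a b : ℝ} (ha : 0 ≤ a)
    (hb : 0 ≤ b) (hab : a + b = 1) : IsSubgradientAt s g y (a • x₁ + b • x₂) := by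
  refine ⟨hg.1 h₁.1 h₂.1 ha hb hab, fun z hz => ?_⟩
  have c := hg.2 h₁.1 h₂.1 ha hb hab
  have d := mul_le_mul_of_nonneg_left (h₁.2 z hz) ha
  have e := mul_le_mul_of_nonneg_left (h₂.2 z hz) hb
  simp only [inner_sub_right, inner_add_right, inner_smul_right, smul_eq_mul] at *
  have : g z = a * g z + b * g z := by rw [← add_mul, hab, one_mul]
  have h3 : ⟪y, z⟫ = a * ⟪y, z⟫ + b * ⟪y, z⟫ := by rw [← add_mul, hab, one_mul]
  linarith

theorem ClosedConvexOn.isSubgradientAt_of_tendsto (hg : ClosedConvexOn s g) {ι : Type*}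
    {l : Filter ι} [l.NeBot] {xs ys : ι → E} {x y : E} (hx : Tendsto xs l (𝓝 x))
    (hy : Tendsto ys l (𝓝 y)) (h : ∀ᶠ i in l, IsSubgradientAt s g (ys i) (xs i)) :
    IsSubgradientAt s g y x := by
  have key : ∀ z ∈ s, x ∈ s ∧ g x ≤ g z - ⟪y, z - x⟫ := by
    intro z hz
    have ht : Tendsto (fun i => (xs i, g z - ⟪ys i, z - xs i⟫)) l
        (𝓝 (x, g z - ⟪y, z - x⟫)) :=
      hx.prodMk_nhds (tendsto_const_nhds.sub (hy.inner (tendsto_const_nhds.sub hx)))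
    refine hg.isClosed_epigraph.mem_of_tendsto ht ?_
    filter_upwards [h] with i hi
    exact ⟨hi.1, by linarith [hi.2 z hz]⟩
  obtain ⟨i, hi⟩ := h.exists
  exact ⟨(key _ hi.1).1, fun z hz => by linarith [(key z hz).2]⟩

/-- Supplies Borel sets on which the laws of two gradients can be compared. -/
theorem ClosedConvexOn.isClosed_image_subgradient (hg : ClosedConvexOn s g) {K : Set E}
    (hK : IsCompact K) : IsClosed {y | ∃ x ∈ K, IsSubgradientAt s g y x} := by
  refine IsSeqClosed.isClosed fun ys y hys hy => ?_
  choose xs hxs hsub using hys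
  obtain ⟨x, hx, φ, hφ, hlim⟩ := hK.tendsto_subseq hxs
  exact ⟨x, hx, hg.isSubgradientAt_of_tendsto hlim (hy.comp hφ.tendsto_atTop)
    (Eventually.of_forall fun i => hsub _)⟩

/-- Testing the subgradient inequality at distance `r / 2` from `x` in the direction of `y` bounds
`‖y‖` by the oscillation of `g` near `p`. -/
theorem exists_norm_subgradient_le {p : E} (hs : s ∈ 𝓝 p) (hc : ContinuousAt g p) :
    ∃ R, ∀ᶠ x in 𝓝 p, ∀ y, IsSubgradientAt s g y x → ‖y‖ ≤ R := by
  have h1 : ∀ᶠ x in 𝓝 p, x ∈ s ∧ dist (g x) (g p) < 1 :=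
    (eventually_mem_set.2 hs).and (Metric.tendsto_nhds.1 hc 1 one_pos)
  obtain ⟨r, hr, hball⟩ := Metric.eventually_nhds_iff_ball.1 h1
  refine ⟨4 / r, Metric.eventually_nhds_iff_ball.2 ⟨r / 2, by positivity, fun x hx y hy => ?_⟩⟩
  rcases eq_or_ne y 0 with rfl | hy0
  · simp; positivity
  have hyn : 0 < ‖y‖ := norm_pos_iff.2 hy0
  set z : E := x + (r / 2 / ‖y‖) • y with hz
  have hzx : ‖z - x‖ = r / 2 := by
    rw [hz, add_sub_cancel_left, norm_smul, Real.norm_of_nonneg (by positivity)]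
    field_simp
  have hzb : z ∈ Metric.ball p r := by
    have h2 : dist z x = r / 2 := by rw [dist_eq_norm, hzx]
    have h3 := dist_triangle z x p
    rw [Metric.mem_ball] at hx ⊢
    linarith
  have hxb : x ∈ Metric.ball p r := Metric.ball_subset_ball (by linarith) hx
  have h4 := hy.2 z (hball z hzb).1
  have h5 := (hball z hzb).2
  have h6 := (hball x hxb).2
  rw [Real.dist_eq, abs_lt] at h5 h6
  have h7 : ⟪y, z - x⟫ = r / 2 * ‖y‖ := by
    rw [hz, add_sub_cancel_left, inner_smul_right, real_inner_self_eq_norm_sq]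
    field_simp
  rw [h7] at h4
  rw [le_div_iff₀ hr]
  linarith

end Subgradient

/-! ### Uniqueness of the gradient with a given law. -/

section Uniqueness

variable {E : Type*} [NormedAddCommGroup E] [InnerProductSpace ℝ E]
  [CompleteSpace E] {s₁ s₂ : Set E} {g₁ g₂ : E → ℝ}

/-- Aleksandrov's lemma: if `g₁` and `g₂ - c` agree at `p` but have different gradients there, then
points near `p` carry no subgradient of `g₂` that is a subgradient of `g₁` at a point where
`g₂ < g₁ + c`. -/
theorem eventually_forall_not_isSubgradientAt [FiniteDimensional ℝ E] (h₂ : ClosedConvexOn s₂ g₂)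
    {p y₁ y₂ : E}
    (hs₁ : s₁ ∈ 𝓝 p) (hs₂ : s₂ ∈ 𝓝 p) (hg₁ : HasGradientAt g₁ y₁ p) (hg₂ : HasGradientAt g₂ y₂ p)
    (hne : y₁ ≠ y₂) : ∀ᶠ x in 𝓝 p, ∀ y k, k ∈ s₂ → g₂ k < g₁ k + (g₂ p - g₁ p) →
      IsSubgradientAt s₂ g₂ y x → ¬ IsSubgradientAt s₁ g₁ y k := by
  by_contra hcon
  rw [not_eventually] at hcon
  push Not at hcon
  obtain ⟨xs, hxs, hP⟩ := exists_seq_forall_of_frequently hcon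
  choose ys ks hks hlt hsub₂ hsub₁ using hP
  obtain ⟨R, hR⟩ := exists_norm_subgradient_le hs₂ hg₂.hasFDerivAt.continuousAt
  have hb : ∃ᶠ n in atTop, ys n ∈ Metric.closedBall (0 : E) R :=
    ((hxs.eventually hR).mono fun n hn => by simpa using hn _ (hsub₂ n)).frequently
  obtain ⟨y, -, φ, hφ, hlim⟩ := tendsto_subseq_of_frequently_bounded Metric.isBounded_closedBall hb
  have hxφ := hxs.comp hφ.tendsto_atTop
  have e₂ : y = y₂ := (h₂.isSubgradientAt_of_tendsto hxφ hlim
    (Eventually.of_forall fun i => hsub₂ _)).eq_of_hasGradientAt hs₂ hg₂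
  -- Chaining the two subgradient inequalities through `ks n` gives an affine minorant of `g₁` of
  -- slope `ys n`; in the limit it touches `g₁` at `p`.
  have hy₁ : IsSubgradientAt s₁ g₁ y p := by
    refine ⟨mem_of_mem_nhds hs₁, fun z hz => ?_⟩
    have ht : Tendsto (fun n => g₂ (xs (φ n)) - (g₂ p - g₁ p) + ⟪ys (φ n), z - xs (φ n)⟫) atTop
        (𝓝 (g₂ p - (g₂ p - g₁ p) + ⟪y, z - p⟫)) :=
      ((hg₂.hasFDerivAt.continuousAt.tendsto.comp hxφ).sub tendsto_const_nhds).add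
        (hlim.inner (tendsto_const_nhds.sub hxφ))
    rw [sub_sub_cancel] at ht
    refine le_of_tendsto' ht fun n => ?_
    have a := (hsub₁ (φ n)).2 z hz
    have b := (hsub₂ (φ n)).2 _ (hks (φ n))
    have c := hlt (φ n)
    simp only [inner_sub_right] at *
    linarith
  exact hne ((hy₁.eq_of_hasGradientAt hs₁ hg₁).symm.trans e₂)

/-- To first order `d` is `⟪a, x - p⟫`, which is at least `r * ‖a‖ / 2` on this ball. Such
off-centre balls contradict density one at `p` for a set which, near `p`, is almost disjoint from
`{0 < d}`. -/
theorem eventually_closedBall_subset {d : E → ℝ} {p a : E} (hd : HasGradientAt d a p)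
    (hp : d p = 0) (ha : a ≠ 0) {U : Set E} (hU : U ∈ 𝓝 p) :
    ∀ᶠ r in 𝓝[>] (0 : ℝ), Metric.closedBall (p + r • (‖a‖⁻¹ • a)) (r / 2) ⊆ U ∩ {x | 0 < d x} := by
  have han : 0 < ‖a‖ := norm_pos_iff.2 ha
  -- As `‖x - p‖ ≤ 3 / 2 * r`, this makes the error at most `3 / 8 * r * ‖a‖`, below the main term.
  have hlo := (hasGradientAt_iff_isLittleO.1 hd).def (c := ‖a‖ / 4) (by positivity)
  obtain ⟨ρ, hρ, hball⟩ := Metric.eventually_nhds_iff_ball.1 (hlo.and hU)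
  have hsmall : ∀ᶠ r in 𝓝[>] (0 : ℝ), r < ρ / 2 :=
    nhdsWithin_le_nhds (gt_mem_nhds (by positivity))
  filter_upwards [hsmall, self_mem_nhdsWithin] with r hr hr0 x hx
  have hr0 : 0 < r := hr0
  set w : E := x - (p + r • (‖a‖⁻¹ • a)) with hw
  have hwn : ‖w‖ ≤ r / 2 := by rwa [Metric.mem_closedBall, dist_eq_norm] at hx
  have hxp : x - p = r • (‖a‖⁻¹ • a) + w := by rw [hw]; abel
  have hn : ‖r • (‖a‖⁻¹ • a)‖ = r := by
    rw [norm_smul, norm_smul, norm_inv, norm_norm, inv_mul_cancel₀ han.ne', mul_one,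
      Real.norm_of_nonneg hr0.le]
  have hxpn : ‖x - p‖ ≤ 3 / 2 * r := by
    rw [hxp]
    linarith [norm_add_le (r • (‖a‖⁻¹ • a)) w]
  have hxb : x ∈ Metric.ball p ρ := by
    rw [Metric.mem_ball, dist_eq_norm]; linarith
  obtain ⟨h1, h2⟩ := hball x hxb
  refine ⟨h2, ?_⟩
  have hin : r * ‖a‖ - r / 2 * ‖a‖ ≤ ⟪a, x - p⟫ := by
    rw [hxp, inner_add_right, inner_smul_right, inner_smul_right, real_inner_self_eq_norm_sq]
    have h3 := neg_le_of_abs_le (abs_real_inner_le_norm a w)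
    have h4 : r * (‖a‖⁻¹ * ‖a‖ ^ 2) = r * ‖a‖ := by field_simp
    have h5 := mul_le_mul_of_nonneg_left hwn han.le
    rw [h4]
    linarith
  rw [hp, sub_zero, Real.norm_eq_abs] at h1
  have h6 := neg_le_of_abs_le h1
  have h7 := mul_le_mul_of_nonneg_left hxpn (show (0 : ℝ) ≤ ‖a‖ / 4 by positivity)
  have h8 : 0 < r * ‖a‖ := by positivity
  change 0 < d x
  linarith

variable [FiniteDimensional ℝ E] [MeasurableSpace E] [BorelSpace E] {μ : Measure E}
  [μ.IsAddHaarMeasure]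

/-- McCann's uniqueness theorem: two gradients of convex functions which have the same law on a set
of finite measure agree almost everywhere there. -/
theorem ae_eq_of_hasGradientAt_of_measure_preimage_eq (h₁ : ClosedConvexOn s₁ g₁)
    (h₂ : ClosedConvexOn s₂ g₂) (hm₁ : Measurable g₁) (hm₂ : Measurable g₂) {Y : Set E}
    (hY : MeasurableSet Y) (hYfin : μ Y ≠ ∞) {F₁ F₂ : E → E}
    (hF₁ : ∀ x ∈ Y, s₁ ∈ 𝓝 x ∧ HasGradientAt g₁ (F₁ x) x)
    (hF₂ : ∀ x ∈ Y, s₂ ∈ 𝓝 x ∧ HasGradientAt g₂ (F₂ x) x)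
    (hlaw : ∀ A, MeasurableSet A → μ (Y ∩ F₁ ⁻¹' A) = μ (Y ∩ F₂ ⁻¹' A)) :
    ∀ᵐ x ∂μ.restrict Y, F₁ x = F₂ x := by
  have sub₁ : ∀ x ∈ Y, IsSubgradientAt s₁ g₁ (F₁ x) x := fun x hx =>
    (hF₁ x hx).2.isSubgradientAt h₁.convexOn (mem_of_mem_nhds (hF₁ x hx).1)
  have sub₂ : ∀ x ∈ Y, IsSubgradientAt s₂ g₂ (F₂ x) x := fun x hx =>
    (hF₂ x hx).2.isSubgradientAt h₂.convexOn (mem_of_mem_nhds (hF₂ x hx).1)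
  -- The factor `2` admits balls of radius `r / 2` whose centres lie at distance `r` from `p`.
  filter_upwards [IsUnifLocDoublingMeasure.ae_tendsto_measure_inter_div μ Y 2,
    ae_restrict_mem hY] with p hdens hpY
  by_contra hne
  set c := g₂ p - g₁ p with hc
  obtain ⟨U, hUp, hUo, hpU⟩ := mem_nhds_iff.1 (eventually_forall_not_isSubgradientAt h₂ (hF₁ p hpY).1
    (hF₂ p hpY).1 (hF₁ p hpY).2 (hF₂ p hpY).2 hne)
  set M : Set E := Y ∩ {x | g₂ x < g₁ x + c} with hM
  have hMm : MeasurableSet M := hY.inter (measurableSet_lt hm₂ (hm₁.add_const c))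
  have hMfin : μ M ≠ ∞ := measure_ne_top_of_subset inter_subset_left hYfin
  -- Points of `Y` whose `F₂`-gradient is a `g₁`-subgradient somewhere on `K ⊆ M` lie in `M` and, by
  -- Aleksandrov's lemma, outside `U`. Equality of laws says that they fill at least the measure of
  -- `K`.
  have hle : μ M ≤ μ (M \ U) := by
    rw [hMm.measure_eq_iSup_isCompact_of_ne_top hMfin]
    refine iSup₂_le fun K hKM => iSup_le fun hK => ?_
    set A := {y | ∃ x ∈ K, IsSubgradientAt s₁ g₁ y x}
    calc μ K ≤ μ (Y ∩ F₁ ⁻¹' A) :=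
          measure_mono fun x hx => ⟨(hKM hx).1, x, hx, sub₁ x (hKM hx).1⟩
      _ = μ (Y ∩ F₂ ⁻¹' A) := hlaw A (h₁.isClosed_image_subgradient hK).measurableSet
      _ ≤ μ (M \ U) := by
          refine measure_mono fun x hx => ?_
          obtain ⟨hxY, k, hkK, hk⟩ := hx
          have hkM := hKM hkK
          refine ⟨⟨hxY, ?_⟩, fun hxU => ?_⟩
          · have a := hk.2 x (sub₁ x hxY).1
            have b := (sub₂ x hxY).2 k (sub₂ k hkM.1).1
            have d : g₂ k < g₁ k + c := hkM.2
            change g₂ x < g₁ x + c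
            simp only [inner_sub_right] at *
            linarith
          · exact hUp hxU _ k (sub₂ k hkM.1).1 hkM.2 (sub₂ x hxY) hk
  have hzero : μ (M ∩ U) = 0 := by
    have h3 := measure_inter_add_sdiff (μ := μ) M hUo.measurableSet
    have h4 : μ (M ∩ U) + μ (M \ U) ≤ 0 + μ (M \ U) := by rw [h3, zero_add]; exact hle
    exact nonpos_iff_eq_zero.1 ((ENNReal.add_le_add_iff_right
      (measure_ne_top_of_subset sdiff_subset hMfin)).1 h4)
  have hd : HasGradientAt (fun x => g₁ x - g₂ x + c) (F₁ p - F₂ p) p := by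
    rw [hasGradientAt_iff_hasFDerivAt, map_sub]
    exact (((hF₁ p hpY).2.hasFDerivAt).sub ((hF₂ p hpY).2.hasFDerivAt)).add_const c
  have hsubset := eventually_closedBall_subset hd (by rw [hc]; ring) (sub_ne_zero.2 hne)
    (hUo.mem_nhds hpU)
  set e := ‖F₁ p - F₂ p‖⁻¹ • (F₁ p - F₂ p)
  have hen : ‖e‖ = 1 := norm_smul_inv_norm (sub_ne_zero.2 hne)
  have hhalf : Tendsto (fun r : ℝ => r / 2) (𝓝[>] 0) (𝓝[>] 0) := by
    refine tendsto_nhdsWithin_iff.2 ⟨?_, ?_⟩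
    · have : Tendsto (fun r : ℝ => r / 2) (𝓝 0) (𝓝 (0 / 2)) := tendsto_id.div_const 2
      rw [zero_div] at this
      exact this.mono_left nhdsWithin_le_nhds
    · filter_upwards [self_mem_nhdsWithin] with r hr
      exact half_pos (mem_Ioi.1 hr)
  have hlim := hdens (fun r : ℝ => p + r • e) (fun r => r / 2) hhalf (by
    filter_upwards [self_mem_nhdsWithin] with r hr
    have hr : 0 < r := hr
    rw [Metric.mem_closedBall, dist_eq_norm, sub_add_cancel_left, norm_neg, norm_smul, hen,
      Real.norm_of_nonneg hr.le]
    linarith)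
  have hlim0 : Tendsto (fun r : ℝ => μ (Y ∩ Metric.closedBall (p + r • e) (r / 2)) /
      μ (Metric.closedBall (p + r • e) (r / 2))) (𝓝[>] 0) (𝓝 0) := by
    refine tendsto_const_nhds.congr' ?_
    filter_upwards [hsubset] with r hr
    have : μ (Y ∩ Metric.closedBall (p + r • e) (r / 2)) = 0 := by
      refine measure_mono_null (fun x hx => ?_) hzero
      have := hr hx.2
      refine ⟨⟨hx.1, ?_⟩, this.1⟩
      have h5 : 0 < g₁ x - g₂ x + c := this.2
      change g₂ x < g₁ x + c
      linarith
    rw [this, ENNReal.zero_div]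
  exact one_ne_zero (tendsto_nhds_unique hlim hlim0)

end Uniqueness

/-! ### Measurable choice of a maximising index. -/

section Argmax

variable {α : Type*}

/-- The least index at most `N` at which `J` is maximal. -/
noncomputable def bestIndex (J : ℕ → α → ℝ) : ℕ → α → ℕ
  | 0, _ => 0
  | N + 1, y => if J (bestIndex J N y) y < J (N + 1) y then N + 1 else bestIndex J N y

theorem bestIndex_le (J : ℕ → α → ℝ) (N : ℕ) (y : α) : bestIndex J N y ≤ N := by
  induction N with
  | zero => simp [bestIndex]
  | succ N ih => rw [bestIndex]; split_ifs <;> omega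

theorem le_bestIndex (J : ℕ → α → ℝ) {i N : ℕ} (h : i ≤ N) (y : α) :
    J i y ≤ J (bestIndex J N y) y := by
  induction N with
  | zero => rw [Nat.le_zero.1 h]; rfl
  | succ N ih =>
    rw [bestIndex]
    rcases Nat.of_le_succ h with h | h
    · have := ih h
      split_ifs with hlt
      · exact this.trans hlt.le
      · exact this
    · subst h
      split_ifs with hlt
      · exact le_rfl
      · exact not_lt.1 hlt

theorem measurable_bestIndex [MeasurableSpace α] {J : ℕ → α → ℝ} (hJ : ∀ i, Measurable (J i))
    (N : ℕ) : Measurable (bestIndex J N) := by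
  induction N with
  | zero => exact measurable_const
  | succ N ih =>
    have h1 : Measurable fun y => J (bestIndex J N y) y :=
      (measurable_from_prod_countable_right (f := fun q : ℕ × α => J q.1 q.2) hJ).comp
        (ih.prodMk measurable_id)
    exact Measurable.ite (measurableSet_lt h1 (hJ _)) measurable_const ih

end Argmax

/-- Compactness: a bounded sequence converges once all its cluster points satisfy a property that
determines them. -/
theorem exists_tendsto_of_forall_subseq {E : Type*} [NormedAddCommGroup E] [ProperSpace E]
    {a : ℕ → E} {R : ℝ} (hb : ∀ n, ‖a n‖ ≤ R) {P : E → Prop}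
    (hP : ∀ φ : ℕ → ℕ, Tendsto φ atTop atTop → ∀ w, Tendsto (fun n => a (φ n)) atTop (𝓝 w) → P w)
    (huniq : ∀ w w', P w → P w' → w = w') : ∃ w, P w ∧ Tendsto a atTop (𝓝 w) := by
  have hmem : ∀ n, a n ∈ Metric.closedBall (0 : E) R := fun n => by simpa using hb n
  obtain ⟨w, -, φ, hφ, hlim⟩ := tendsto_subseq_of_bounded Metric.isBounded_closedBall hmem
  have hw := hP φ hφ.tendsto_atTop w hlim
  refine ⟨w, hw, tendsto_of_subseq_tendsto fun ns hns => ?_⟩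
  obtain ⟨w', -, ms, hms, hlim'⟩ := tendsto_subseq_of_bounded Metric.isBounded_closedBall
    fun n => hmem (ns n)
  refine ⟨ms, ?_⟩
  rw [huniq w w' hw (hP _ (hns.comp hms.tendsto_atTop) w' hlim')]
  exact hlim'

/-! ### Approximating the preimage of least norm. -/

section Selection

variable {E : Type*} [NormedAddCommGroup E] [InnerProductSpace ℝ E] {s : Set E} {g : E → ℝ}

/-- The parallelogram law, used as strict convexity of the squared norm. -/
theorem eq_of_norm_sq_add_le_midpoint {w w' : E} {r : ℝ} (hw : ‖w‖ ^ 2 + ‖w'‖ ^ 2 ≤ 2 * r)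
    (hr : r ≤ ‖(2⁻¹ : ℝ) • w + (2⁻¹ : ℝ) • w'‖ ^ 2) : w = w' := by
  have h1 := parallelogram_law_with_norm ℝ w w'
  have h2 : ‖(2⁻¹ : ℝ) • w + (2⁻¹ : ℝ) • w'‖ ^ 2 = ‖w + w'‖ ^ 2 / 4 := by
    rw [← smul_add, norm_smul, mul_pow]; norm_num; ring
  have h3 : ‖w - w'‖ ^ 2 ≤ 0 := by nlinarith
  exact sub_eq_zero.1 (norm_eq_zero.1 (pow_eq_zero_iff two_ne_zero |>.1
    (le_antisymm h3 (sq_nonneg _))))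

/-- `x` is the point of least norm at which `y` is a subgradient. -/
def IsMinimalPreimage (s : Set E) (g : E → ℝ) (y x : E) : Prop :=
  IsSubgradientAt s g y x ∧ ∀ z, IsSubgradientAt s g y z → ‖x‖ ≤ ‖z‖

theorem IsMinimalPreimage.eq (hg : ConvexOn ℝ s g) {y w w' : E} (h : IsMinimalPreimage s g y w)
    (h' : IsMinimalPreimage s g y w') : w = w' := by
  have hm := h.1.combo hg h'.1 (a := 2⁻¹) (b := 2⁻¹) (by norm_num) (by norm_num) (by norm_num)
  have he : ‖w‖ = ‖w'‖ := le_antisymm (h.2 _ h'.1) (h'.2 _ h.1)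
  refine eq_of_norm_sq_add_le_midpoint (r := ‖w‖ ^ 2) (by rw [← he]; linarith) ?_
  have := h.2 _ hm
  gcongr

theorem ClosedConvexOn.add_norm_sq (hg : ClosedConvexOn s g) {ε : ℝ} (hε : 0 ≤ ε) :
    ClosedConvexOn s (fun z => g z + ε * ‖z‖ ^ 2) := by
  refine ⟨hg.convexOn.add ?_, ?_⟩
  · exact (((convexOn_norm hg.convexOn.1).pow (fun _ _ => norm_nonneg _) 2).smul hε)
  · have : Continuous fun p : E × ℝ => (p.1, p.2 - ε * ‖p.1‖ ^ 2) := by fun_prop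
    convert hg.isClosed_epigraph.preimage this using 1
    ext p
    simp [le_sub_iff_add_le]

theorem IsSubgradientAt.eq_of_add_norm_sq (hg : ConvexOn ℝ s g) {ε : ℝ} (hε : 0 < ε) {y w w' : E}
    (h : IsSubgradientAt s (fun z => g z + ε * ‖z‖ ^ 2) y w)
    (h' : IsSubgradientAt s (fun z => g z + ε * ‖z‖ ^ 2) y w') : w = w' := by
  have hz : (2⁻¹ : ℝ) • w + (2⁻¹ : ℝ) • w' ∈ s :=
    hg.1 h.1 h'.1 (by norm_num) (by norm_num) (by norm_num)
  have hc : g ((2⁻¹ : ℝ) • w + (2⁻¹ : ℝ) • w') ≤ (2⁻¹ : ℝ) • g w + (2⁻¹ : ℝ) • g w' :=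
    hg.2 h.1 h'.1 (by norm_num) (by norm_num) (by norm_num)
  have a := h.2 _ hz
  have b := h'.2 _ hz
  refine eq_of_norm_sq_add_le_midpoint (r := ‖(2⁻¹ : ℝ) • w + (2⁻¹ : ℝ) • w'‖ ^ 2) ?_ le_rfl
  simp only [inner_sub_right, inner_add_right, inner_smul_right, smul_eq_mul] at a b hc
  have : ε * (‖w‖ ^ 2 + ‖w'‖ ^ 2) ≤ ε * (2 * ‖(2⁻¹ : ℝ) • w + (2⁻¹ : ℝ) • w'‖ ^ 2) := by linarith
  exact le_of_mul_le_mul_left this hε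

/-- An affine minorant of slope `y` cancels the linear term, leaving only the quadratic penalty:
this is the coercivity needed for maximisers to stay bounded. -/
theorem IsSubgradientAt.exists_bound_add_norm_sq {y x : E} (h : IsSubgradientAt s g y x) {ε : ℝ}
    (hε : 0 < ε) (c : ℝ) :
    ∃ R, ∀ z ∈ s, c ≤ ⟪y, z⟫ - (g z + ε * ‖z‖ ^ 2) → ‖z‖ ≤ R := by
  refine ⟨Real.sqrt ((⟪y, x⟫ - g x - c) / ε), fun z hz hc => Real.le_sqrt_of_sq_le ?_⟩
  rw [le_div_iff₀ hε]
  have := h.2 z hz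
  rw [inner_sub_right] at this
  linarith

variable [FiniteDimensional ℝ E]

/-- Maximising the affine functions `⟪·, a⟫ - b` over more and more points `(a, b)` of a dense
sequence in the epigraph produces the point at which `y` is a subgradient, if there is just one. -/
theorem ClosedConvexOn.exists_tendsto_bestIndex (hg : ClosedConvexOn s g) {p : ℕ → E × ℝ}
    (hp : ∀ i, (p i).1 ∈ s ∧ g (p i).1 ≤ (p i).2)
    (hdense : ∀ x ∈ s, (x, g x) ∈ closure (range p)) {y : E}
    (hb : ∀ c, ∃ R, ∀ z ∈ s, c ≤ ⟪y, z⟫ - g z → ‖z‖ ≤ R)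
    (huniq : ∀ w w', IsSubgradientAt s g y w → IsSubgradientAt s g y w' → w = w') :
    ∃ w, IsSubgradientAt s g y w ∧ Tendsto
      (fun N => (p (bestIndex (fun i y => ⟪y, (p i).1⟫ - (p i).2) N y)).1) atTop (𝓝 w) := by
  set J : ℕ → E → ℝ := fun i y => ⟪y, (p i).1⟫ - (p i).2 with hJ
  have : ProperSpace E := FiniteDimensional.proper ℝ E
  obtain ⟨R, hR⟩ := hb (J 0 y)
  refine exists_tendsto_of_forall_subseq (R := R) (fun N => hR _ (hp _).1 ?_) ?_ huniq
  · have h1 := le_bestIndex J (Nat.zero_le N) y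
    have h2 := (hp (bestIndex J N y)).2
    simp only [hJ] at h1 ⊢
    linarith
  · intro φ hφ w hw
    have key : ∀ z ∈ s, ∀ δ > 0, w ∈ s ∧ g w ≤ ⟪y, w⟫ - (⟪y, z⟫ - g z) + δ := by
      intro z hz δ hδ
      have hU : IsOpen {q : E × ℝ | ⟪y, z⟫ - g z - δ < ⟪y, q.1⟫ - q.2} :=
        isOpen_lt continuous_const (by fun_prop)
      obtain ⟨_, hq, i, rfl⟩ := mem_closure_iff.1 (hdense z hz) _ hU
        (show ⟪y, z⟫ - g z - δ < ⟪y, z⟫ - g z by linarith)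
      have hq : ⟪y, z⟫ - g z - δ < ⟪y, (p i).1⟫ - (p i).2 := hq
      have ht : Tendsto (fun n => ((p (bestIndex J (φ n) y)).1,
          ⟪y, (p (bestIndex J (φ n) y)).1⟫ - (⟪y, z⟫ - g z) + δ)) atTop
          (𝓝 (w, ⟪y, w⟫ - (⟪y, z⟫ - g z) + δ)) :=
        hw.prodMk_nhds (((tendsto_const_nhds.inner hw).sub_const _).add_const _)
      refine hg.isClosed_epigraph.mem_of_tendsto ht ?_
      filter_upwards [hφ.eventually_ge_atTop i] with n hn
      refine ⟨(hp _).1, ?_⟩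
      have h1 := le_bestIndex J hn y
      have h2 := (hp (bestIndex J (φ n) y)).2
      simp only [hJ] at h1 h2 ⊢
      linarith
    refine ⟨(key _ (hp 0).1 1 one_pos).1, fun z hz => ?_⟩
    have : g w ≤ ⟪y, w⟫ - (⟪y, z⟫ - g z) := le_of_forall_pos_le_add fun δ hδ => (key z hz δ hδ).2
    rw [inner_sub_right]
    linarith

/-- The regularised preimages of `y` converge to the preimage of least norm. -/
theorem ClosedConvexOn.exists_tendsto_regularised (hg : ClosedConvexOn s g) {y x : E}
    (hx : IsSubgradientAt s g y x) {ε : ℕ → ℝ} (hε : ∀ k, 0 < ε k) (hε0 : Tendsto ε atTop (𝓝 0))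
    {w : ℕ → E} (hw : ∀ k, IsSubgradientAt s (fun z => g z + ε k * ‖z‖ ^ 2) y (w k)) :
    ∃ v, IsMinimalPreimage s g y v ∧ Tendsto w atTop (𝓝 v) := by
  have : ProperSpace E := FiniteDimensional.proper ℝ E
  -- `z` minimises `g - ⟪y, ·⟫` and `w k` minimises the penalised function, so the penalty at `w k`
  -- cannot exceed that at `z`.
  have hle : ∀ z, IsSubgradientAt s g y z → ∀ k, ‖w k‖ ≤ ‖z‖ := by
    intro z hz k
    have a := (hw k).2 z hz.1
    have b := hz.2 _ (hw k).1
    simp only [inner_sub_right] at a b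
    have : ε k * ‖w k‖ ^ 2 ≤ ε k * ‖z‖ ^ 2 := by linarith
    exact (sq_le_sq₀ (norm_nonneg _) (norm_nonneg _)).1 (le_of_mul_le_mul_left this (hε k))
  refine exists_tendsto_of_forall_subseq (hle x hx) ?_ fun v v' h h' => h.eq hg.convexOn h'
  intro φ hφ v hv
  refine ⟨?_, fun z hz => le_of_tendsto' hv.norm fun n => hle z hz _⟩
  have key : ∀ z ∈ s, v ∈ s ∧ g v ≤ g z + 0 * ‖z‖ ^ 2 - ⟪y, z - v⟫ := by
    intro z hz
    have ht : Tendsto (fun n => (w (φ n), g z + ε (φ n) * ‖z‖ ^ 2 - ⟪y, z - w (φ n)⟫)) atTop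
        (𝓝 (v, g z + 0 * ‖z‖ ^ 2 - ⟪y, z - v⟫)) :=
      hv.prodMk_nhds ((tendsto_const_nhds.add ((hε0.comp hφ).mul_const _)).sub
        (tendsto_const_nhds.inner (tendsto_const_nhds.sub hv)))
    refine hg.isClosed_epigraph.mem_of_tendsto ht (Eventually.of_forall fun n => ?_)
    refine ⟨(hw _).1, ?_⟩
    have a := (hw (φ n)).2 z hz
    have b : 0 ≤ ε (φ n) * ‖w (φ n)‖ ^ 2 := mul_nonneg (hε _).le (sq_nonneg _)
    simp only at a ⊢
    linarith
  exact ⟨(key x hx.1).1, fun z hz => by linarith [(key z hz).2]⟩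

end Selection

/-! ### Volume bounds along the selection. -/

section Contraction

variable {E : Type*} [NormedAddCommGroup E] [InnerProductSpace ℝ E] [MeasurableSpace E]

/-- Moving the points of `G` towards their images under `W` shrinks the measure of a set by at
most the factor `(1 - t) ^ n`. -/
def ContractsAlong (μ : Measure E) (G : Set E) (W : E → E) : Prop :=
  ∀ t ∈ Ico (0 : ℝ) 1, ∀ O, IsOpen O →
    ENNReal.ofReal ((1 - t) ^ Module.finrank ℝ E) * μ (G ∩ {x | (1 - t) • x + t • W x ∈ O}) ≤ μ O

/-- A point whose limit position lies in the open set `O` has a whole tail of positions in `O`, so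
continuity of the measure along increasing unions suffices. -/
theorem contractsAlong_of_tendsto {μ : Measure E} {G : Set E} {Ws : ℕ → E → E} {W : E → E}
    (hWs : ∀ k, ContractsAlong μ G (Ws k))
    (hlim : ∀ x ∈ G, Tendsto (fun k => Ws k x) atTop (𝓝 (W x))) : ContractsAlong μ G W := by
  intro t ht O hO
  have hsub : G ∩ {x | (1 - t) • x + t • W x ∈ O} ⊆
      ⋃ N : ℕ, ⋂ k ≥ N, G ∩ {x | (1 - t) • x + t • Ws k x ∈ O} := by
    rintro x ⟨hxG, hx⟩
    have h1 : Tendsto (fun k => (1 - t) • x + t • Ws k x) atTop (𝓝 ((1 - t) • x + t • W x)) :=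
      tendsto_const_nhds.add ((hlim x hxG).const_smul t)
    obtain ⟨N, hN⟩ := eventually_atTop.1 (h1.eventually_mem (hO.mem_nhds hx))
    exact mem_iUnion.2 ⟨N, mem_iInter₂.2 fun k hk => ⟨hxG, hN k hk⟩⟩
  refine (mul_le_mul_right (measure_mono hsub) _).trans ?_
  rw [Monotone.measure_iUnion, ENNReal.mul_iSup]
  · exact iSup_le fun N => (mul_le_mul_right
      (measure_mono (iInter₂_subset N le_rfl)) _).trans (hWs N t ht O hO)
  · exact fun N M hNM => iInter₂_mono' fun k hk => ⟨k, hNM.trans hk, subset_rfl⟩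

/-- Outer regularity removes the openness that the passage to limits required. -/
theorem ContractsAlong.measure_le {μ : Measure E} [μ.OuterRegular] {G : Set E}
    {W : E → E} (h : ContractsAlong μ G W) {t : ℝ} (ht : t ∈ Ico (0 : ℝ) 1) (A : Set E) :
    ENNReal.ofReal ((1 - t) ^ Module.finrank ℝ E) * μ (G ∩ {x | (1 - t) • x + t • W x ∈ A}) ≤
      μ A := by
  rw [A.measure_eq_iInf_isOpen]
  refine le_iInf₂ fun O hAO => le_iInf fun hO => le_trans ?_ (h t ht O hO)
  gcongr

theorem ContractsAlong.measure_eq_zero {μ : Measure E} [μ.OuterRegular] {G : Set E}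
    {W : E → E} (h : ContractsAlong μ G W) {t : ℝ} (ht : t ∈ Ico (0 : ℝ) 1) {A : Set E}
    (hA : μ A = 0) : μ (G ∩ {x | (1 - t) • x + t • W x ∈ A}) = 0 := by
  have h1 := h.measure_le ht A
  rw [hA, nonpos_iff_eq_zero, mul_eq_zero] at h1
  refine h1.resolve_left (ENNReal.ofReal_pos.2 (pow_pos (sub_pos.2 ht.2) _)).ne'

variable [FiniteDimensional ℝ E] [CompleteSpace E] [BorelSpace E] {μ : Measure E}
  [μ.IsAddHaarMeasure] {s : Set E} {g : E → ℝ} {G : Set E} {F : E → E}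

/-- Countably many homotheties towards points chosen monotonically in terms of the gradient have
disjoint images. -/
theorem contractsAlong_of_monotone (hg : ConvexOn ℝ s g) (hG : MeasurableSet G)
    (hF : ∀ x ∈ G, s ∈ 𝓝 x ∧ HasGradientAt g (F x) x) (hFm : Measurable F) {idx : E → ℕ}
    (hidx : Measurable idx) {a : ℕ → E}
    (hmono : ∀ y₁ y₂, 0 ≤ ⟪y₁ - y₂, a (idx y₁) - a (idx y₂)⟫) {W : E → E}
    (hW : ∀ x ∈ G, W x = a (idx (F x))) : ContractsAlong μ G W := by
  have hsub : ∀ x ∈ G, IsSubgradientAt s g (F x) x := fun x hx =>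
    (hF x hx).2.isSubgradientAt hg (mem_of_mem_nhds (hF x hx).1)
  intro t ht O hO
  have ht' : 0 < 1 - t := sub_pos.2 ht.2
  set h : ℕ → E → E := fun i => AffineMap.homothety (a i) (1 - t) with hh
  have happ : ∀ i x, h i x = (1 - t) • x + t • a i := by
    intro i x
    simp only [hh, AffineMap.homothety_apply, vsub_eq_sub, vadd_eq_add]
    module
  have hcont : ∀ i, Continuous (h i) := fun i => by
    have : h i = fun x => (1 - t) • x + t • a i := funext (happ i)
    rw [this]; fun_prop
  have hinj : ∀ i, Function.Injective (h i) := fun i x x' hxx => by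
    rw [happ, happ, add_left_inj] at hxx
    exact smul_right_injective E ht'.ne' hxx
  set P : ℕ → Set E := fun i => G ∩ F ⁻¹' (idx ⁻¹' {i}) ∩ h i ⁻¹' O with hP
  have hPm : ∀ i, MeasurableSet (P i) := fun i =>
    (hG.inter (hFm (hidx (measurableSet_singleton i)))).inter (hO.preimage (hcont i)).measurableSet
  have hcover : G ∩ {x | (1 - t) • x + t • W x ∈ O} = ⋃ i, P i := by
    ext x
    simp only [hP, mem_iUnion, mem_inter_iff, mem_preimage, mem_singleton_iff, mem_ofPred_eq, happ]
    constructor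
    · rintro ⟨hxG, hx⟩
      exact ⟨_, ⟨hxG, rfl⟩, by rwa [← hW x hxG]⟩
    · rintro ⟨i, ⟨hxG, rfl⟩, hx⟩
      exact ⟨hxG, by rwa [hW x hxG]⟩
  have hdisjP : Pairwise (Function.onFun Disjoint P) := by
    intro i j hij
    refine disjoint_left.2 fun x hx hx' => hij ?_
    rw [← show idx (F x) = i from hx.1.2, ← show idx (F x) = j from hx'.1.2]
  have hdisj : Pairwise (Function.onFun Disjoint fun i => h i '' P i) := by
    intro i j hij
    refine disjoint_left.2 ?_
    rintro _ ⟨x₁, hx₁, rfl⟩ ⟨x₂, hx₂, he⟩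
    have i₁ : idx (F x₁) = i := hx₁.1.2
    have i₂ : idx (F x₂) = j := hx₂.1.2
    have m₁ := (hsub x₁ hx₁.1.1).inner_nonneg (hsub x₂ hx₂.1.1)
    have m₂ := hmono (F x₁) (F x₂)
    rw [i₁, i₂] at m₂
    rw [happ, happ] at he
    -- At a common image point two terms, each nonnegative by monotonicity, add up to zero. The
    -- equality case then forces `F x₁ = F x₂`, hence `i = j`.
    have h0 : (1 - t) * ⟪F x₁ - F x₂, x₁ - x₂⟫ + t * ⟪F x₁ - F x₂, a i - a j⟫ = 0 := by
      rw [← inner_smul_right, ← inner_smul_right, ← inner_add_right]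
      have : (1 - t) • (x₁ - x₂) + t • (a i - a j) = 0 := by
        rw [smul_sub, smul_sub, sub_add_sub_comm, he, sub_self]
      rw [this, inner_zero_right]
    have h1 : ⟪F x₁ - F x₂, x₁ - x₂⟫ ≤ 0 := by
      have := mul_nonneg ht.1 m₂
      by_contra hpos
      have := mul_pos ht' (not_le.1 hpos)
      linarith
    have h2 := ((hsub x₁ hx₁.1.1).isSubgradientAt_of_inner_le (hsub x₂ hx₂.1.1)
      h1).eq_of_hasGradientAt (hF x₂ hx₂.1.1).1 (hF x₂ hx₂.1.1).2
    exact hij (i₁.symm.trans (by rw [h2, i₂]))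
  rw [hcover, measure_iUnion hdisjP hPm, ← ENNReal.tsum_mul_left]
  calc ∑' i, ENNReal.ofReal ((1 - t) ^ Module.finrank ℝ E) * μ (P i)
      = ∑' i, μ (h i '' P i) := by
        refine tsum_congr fun i => ?_
        rw [hh, Measure.addHaar_image_homothety, abs_of_pos (pow_pos ht' _)]
    _ ≤ μ (⋃ i, h i '' P i) := tsum_meas_le_meas_iUnion_of_disjoint _
        (fun i => (hPm i).image_of_continuousOn_injOn (hcont i).continuousOn (hinj i).injOn) hdisj
    _ ≤ μ O := measure_mono (iUnion_subset fun i => image_subset_iff.2 inter_subset_right)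

/-- The quadratic term makes the preimage unique, so it is the limit of maximisers over the first
points of a dense sequence in the epigraph. Each such maximiser takes finitely many values and is
monotone in `F x`, so the homothety argument applies and passes to the limit. -/
theorem exists_contractsAlong_regularised (hg : ClosedConvexOn s g) (hG : MeasurableSet G)
    (hF : ∀ x ∈ G, s ∈ 𝓝 x ∧ HasGradientAt g (F x) x) (hFm : Measurable F) {ε : ℝ} (hε : 0 < ε) :
    ∃ W : E → E, Measurable W ∧ ContractsAlong μ G W ∧
      ∀ x ∈ G, IsSubgradientAt s (fun z => g z + ε * ‖z‖ ^ 2) (F x) (W x) := by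
  classical
  have hsub : ∀ x ∈ G, IsSubgradientAt s g (F x) x := fun x hx =>
    (hF x hx).2.isSubgradientAt hg.convexOn (mem_of_mem_nhds (hF x hx).1)
  rcases G.eq_empty_or_nonempty with rfl | ⟨x₀, hx₀⟩
  · exact ⟨id, measurable_id, fun t _ O _ => by simp, fun x hx => hx.elim⟩
  set f : E → ℝ := fun z => g z + ε * ‖z‖ ^ 2 with hf
  have hfc : ClosedConvexOn s f := hg.add_norm_sq hε.le
  set epi : Set (E × ℝ) := {p | p.1 ∈ s ∧ f p.1 ≤ p.2} with hepi
  have : Nonempty epi := ⟨(x₀, f x₀), (hsub x₀ hx₀).1, le_rfl⟩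
  set p : ℕ → E × ℝ := fun i => (TopologicalSpace.denseSeq epi i : E × ℝ) with hp
  have hpm : ∀ i, (p i).1 ∈ s ∧ f (p i).1 ≤ (p i).2 := fun i =>
    (TopologicalSpace.denseSeq epi i).2
  have hpd : ∀ x ∈ s, (x, f x) ∈ closure (range p) := by
    intro x hx
    have h1 : (⟨(x, f x), hx, le_rfl⟩ : epi) ∈ closure (range (TopologicalSpace.denseSeq epi)) :=
      TopologicalSpace.denseRange_denseSeq epi _
    have h2 := image_closure_subset_closure_image continuous_subtype_val (mem_image_of_mem _ h1)
    rwa [← range_comp] at h2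
  set J : ℕ → E → ℝ := fun i y => ⟪y, (p i).1⟫ - (p i).2 with hJ
  have hJm : ∀ i, Measurable (J i) := fun i => by
    have : Continuous (J i) := by simp only [hJ]; fun_prop
    exact this.measurable
  -- Each of the two chosen indices competes in the other maximisation; add the two inequalities.
  have hmono : ∀ N y₁ y₂, 0 ≤ ⟪y₁ - y₂, (p (bestIndex J N y₁)).1 - (p (bestIndex J N y₂)).1⟫ := by
    intro N y₁ y₂
    have a := le_bestIndex J (bestIndex_le J N y₂) y₁
    have b := le_bestIndex J (bestIndex_le J N y₁) y₂
    simp only [hJ, inner_sub_left, inner_sub_right] at a b ⊢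
    linarith
  -- Convergence is known only on `G`; the indicator gives a limit everywhere and so a measurable
  -- `W`.
  set Ws : ℕ → E → E := fun N => G.indicator fun x => (p (bestIndex J N (F x))).1 with hWs
  have hWsm : ∀ N, Measurable (Ws N) := fun N =>
    ((measurable_from_nat (f := fun i => (p i).1)).comp
      ((measurable_bestIndex hJm N).comp hFm)).indicator hG
  have hlim : ∀ x, ∃ w, (x ∈ G → IsSubgradientAt s f (F x) w) ∧
      Tendsto (fun N => Ws N x) atTop (𝓝 w) := by
    intro x
    by_cases hx : x ∈ G
    · obtain ⟨w, hw, hlim⟩ := hfc.exists_tendsto_bestIndex hpm hpd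
        ((hsub x hx).exists_bound_add_norm_sq hε)
        (fun w w' h h' => h.eq_of_add_norm_sq hg.convexOn hε h')
      exact ⟨w, fun _ => hw, by simpa only [hWs, indicator_of_mem hx] using hlim⟩
    · exact ⟨0, fun h => (hx h).elim, by simp [hWs, hx]⟩
  choose W hWsub hWlim using hlim
  refine ⟨W, measurable_of_tendsto_metrizable hWsm (tendsto_pi_nhds.2 hWlim),
    contractsAlong_of_tendsto (fun N => ?_) fun x _ => hWlim x, hWsub⟩
  exact contractsAlong_of_monotone hg.convexOn hG hF hFm (measurable_bestIndex hJm N)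
    (a := fun i => (p i).1) (hmono N) fun x hx => indicator_of_mem hx _

/-- The preimage of least norm of the gradient is a measurable selection, and the measure contracts
along it. -/
theorem exists_contractsAlong_isMinimalPreimage (hg : ClosedConvexOn s g) (hG : MeasurableSet G)
    (hF : ∀ x ∈ G, s ∈ 𝓝 x ∧ HasGradientAt g (F x) x) (hFm : Measurable F) :
    ∃ W : E → E, Measurable W ∧ ContractsAlong μ G W ∧
      ∀ x ∈ G, IsMinimalPreimage s g (F x) (W x) := by
  classical
  have hε : ∀ k : ℕ, (0 : ℝ) < 1 / (k + 1) := fun k => Nat.one_div_pos_of_nat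
  choose Ws hWsm hWsc hWss using fun k : ℕ =>
    exists_contractsAlong_regularised (μ := μ) hg hG hF hFm (hε k)
  have hlim : ∀ x, ∃ w, (x ∈ G → IsMinimalPreimage s g (F x) w) ∧
      Tendsto (fun k => G.indicator (Ws k) x) atTop (𝓝 w) := by
    intro x
    by_cases hx : x ∈ G
    · obtain ⟨w, hw, hlim⟩ := hg.exists_tendsto_regularised
        ((hF x hx).2.isSubgradientAt hg.convexOn (mem_of_mem_nhds (hF x hx).1)) hε
        tendsto_one_div_add_atTop_nhds_zero_nat fun k => hWss k x hx
      exact ⟨w, fun _ => hw, by simpa only [indicator_of_mem hx] using hlim⟩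
    · exact ⟨0, fun h => (hx h).elim, by simp [hx]⟩
  choose W hWsub hWlim using hlim
  refine ⟨W, measurable_of_tendsto_metrizable (fun k => (hWsm k).indicator hG)
    (tendsto_pi_nhds.2 hWlim), contractsAlong_of_tendsto hWsc fun x hx => ?_, hWsub⟩
  simpa only [indicator_of_mem hx] using hWlim x

end Contraction

/-! ### Countable fibres force injectivity. -/

section CountableFibres

/-- Tonelli: countable sets of times are null, so if all were countable `D` would be null, and so
would almost all its sections over `t`. -/
theorem exists_not_countable_of_forall_measure_ne_zero {E : Type*} [MeasurableSpace E]
    {μ : Measure E} [SFinite μ] {D : Set (ℝ × E)} (hD : MeasurableSet D) {δ : ℝ} (hδ : 0 < δ)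
    (h : ∀ t ∈ Ioo 0 δ, μ (Prod.mk t ⁻¹' D) ≠ 0) :
    ∃ x, ¬ {t | (t, x) ∈ D}.Countable := by
  by_contra! hcon
  have h0 : (volume.prod μ) D = 0 := by
    rw [Measure.prod_apply_symm hD]
    exact (lintegral_congr fun x => (hcon x).measure_zero _).trans lintegral_zero
  have h1 := (Measure.measure_prod_null hD).1 h0
  have h2 : volume (Ioo 0 δ) = 0 :=
    measure_mono_null (fun t ht => by simpa using h t ht) (ae_iff.1 h1)
  rw [Real.volume_Ioo, sub_zero, ENNReal.ofReal_eq_zero] at h2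
  linarith

variable {E : Type*} [NormedAddCommGroup E] [InnerProductSpace ℝ E] [MeasurableSpace E]
  [FiniteDimensional ℝ E] [BorelSpace E] {μ : Measure E}
  [μ.IsAddHaarMeasure] {s : Set E} {g : E → ℝ} {G : Set E} {F : E → E}

/-- If the measure contracts along `W` and almost every point of `K` lies in `C`, then some segment
from a point `x` of `K` to `W x` meets `K ∩ C` at uncountably many times. -/
theorem ContractsAlong.exists_not_countable {W : E → E} (hW : ContractsAlong μ G W)
    (hWm : Measurable W) {K C : Set E} (hK : IsCompact K) (hKG : K ⊆ G) (hKpos : μ K ≠ 0)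
    (hC : μ (K \ C) = 0) :
    ∃ x ∈ K, ¬ {t : ℝ | t ∈ Ioo (0 : ℝ) 1 ∧ (1 - t) • x + t • W x ∈ K ∩ C}.Countable := by
  set T : ℝ → E → E := fun t x => (1 - t) • x + t • W x with hT
  have hTm : Measurable fun q : ℝ × E => T q.1 q.2 := by
    have : Measurable fun q : ℝ × E => W q.2 := hWm.comp measurable_snd
    simp only [hT]
    fun_prop
  have hKfin : μ K ≠ ∞ := hK.measure_ne_top
  set κ : ℝ≥0∞ := ENNReal.ofReal ((1 / 2) ^ Module.finrank ℝ E) with hκ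
  have hκ0 : κ ≠ 0 := (ENNReal.ofReal_pos.2 (by positivity)).ne'
  have hκt : κ ≠ ∞ := ENNReal.ofReal_ne_top
  have hκK : κ * (μ K / 2) ≠ 0 := mul_ne_zero hκ0 (ENNReal.half_pos hKpos).ne'
  -- For `t < 1 / 2` the contraction factor exceeds `κ`, so at most `μ K / 2` of the points can land
  -- in `O \ K`. More than that stays in `O` for all short times, leaving positive measure to land
  -- in `K`.
  obtain ⟨O, hKO, hO, -, hOK⟩ := hK.measurableSet.exists_isOpen_sdiff_lt hKfin hκK
  set A : ℕ → Set E := fun j => {x ∈ K | ∀ t ∈ Ioo (0 : ℝ) (1 / (j + 1)), T t x ∈ O} with hA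
  have hAmono : Monotone A := fun i j hij x hx => ⟨hx.1, fun t ht => hx.2 t
    ⟨ht.1, ht.2.trans_le (one_div_le_one_div_of_le (by positivity) (by gcongr))⟩⟩
  have hAK : K ⊆ ⋃ j, A j := by
    intro x hx
    have hc : Continuous fun t => T t x := by simp only [hT]; fun_prop
    have h0 : T 0 x ∈ O := by simpa [hT] using hKO hx
    obtain ⟨r, hr, hball⟩ := Metric.mem_nhds_iff.1 (hc.continuousAt.preimage_mem_nhds
      (hO.mem_nhds h0))
    obtain ⟨j, hj⟩ := exists_nat_one_div_lt hr
    refine mem_iUnion.2 ⟨j, hx, fun t ht => hball ?_⟩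
    rw [Metric.mem_ball, Real.dist_eq, sub_zero, abs_of_pos ht.1]
    exact ht.2.trans hj
  obtain ⟨j, hj⟩ : ∃ j, μ K / 2 < μ (A j) := by
    by_contra! hcon
    have h1 : μ K ≤ μ K / 2 := by
      refine (measure_mono hAK).trans ?_
      rw [hAmono.measure_iUnion]
      exact iSup_le hcon
    exact h1.not_gt (ENNReal.half_lt_self hKpos hKfin)
  set δ : ℝ := min (1 / (j + 1)) (1 / 2) with hδ
  have hδ0 : 0 < δ := lt_min Nat.one_div_pos_of_nat (by norm_num)
  set N := toMeasurable μ (K \ C) with hN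
  have hNm : MeasurableSet N := measurableSet_toMeasurable _ _
  have hN0 : μ N = 0 := by rw [hN, measure_toMeasurable, hC]
  set D : Set (ℝ × E) := (Ioo 0 δ ×ˢ K) ∩ (fun q => T q.1 q.2) ⁻¹' (K \ N) with hD
  have hDm : MeasurableSet D := (measurableSet_Ioo.prod hK.measurableSet).inter
    (hTm (hK.measurableSet.diff hNm))
  have hpos : ∀ t ∈ Ioo 0 δ, μ (Prod.mk t ⁻¹' D) ≠ 0 := by
    intro t ht h0
    have ht2 : t < 1 / 2 := ht.2.trans_le (min_le_right _ _)
    have ht1 : t ∈ Ico (0 : ℝ) 1 := ⟨ht.1.le, by linarith⟩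
    have hOK' : μ (G ∩ {x | T t x ∈ O \ K}) ≤ μ K / 2 := by
      have h1 : κ * μ (G ∩ {x | T t x ∈ O \ K}) ≤ κ * (μ K / 2) := by
        refine le_trans ?_ ((hW.measure_le ht1 (O \ K)).trans hOK.le)
        gcongr
        exact ENNReal.ofReal_le_ofReal (pow_le_pow_left₀ (by norm_num) (by linarith) _)
      exact (ENNReal.mul_le_mul_iff_right hκ0 hκt).1 h1
    have hN' : μ (G ∩ {x | T t x ∈ N}) = 0 := hW.measure_eq_zero ht1 hN0
    have hsub : A j ⊆ (Prod.mk t ⁻¹' D ∪ (G ∩ {x | T t x ∈ N})) ∪ (G ∩ {x | T t x ∈ O \ K}) := by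
      intro x hx
      have hxO : T t x ∈ O := hx.2 t ⟨ht.1, ht.2.trans_le (min_le_left _ _)⟩
      by_cases hxK : T t x ∈ K
      · by_cases hxN : T t x ∈ N
        · exact Or.inl (Or.inr ⟨hKG hx.1, hxN⟩)
        · exact Or.inl (Or.inl ⟨⟨ht, hx.1⟩, hxK, hxN⟩)
      · exact Or.inr ⟨hKG hx.1, hxO, hxK⟩
    refine hj.not_ge ((measure_mono hsub).trans ((measure_union_le _ _).trans ?_))
    rw [measure_union_null h0 hN', zero_add]
    exact hOK'
  obtain ⟨x, hx⟩ := exists_not_countable_of_forall_measure_ne_zero hDm hδ0 hpos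
  have hxK : x ∈ K := by
    by_contra hxK
    exact hx (by simp [hD, hxK])
  refine ⟨x, hxK, fun hcount => hx (hcount.mono fun t ht => ?_)⟩
  have h1 : t < 1 / 2 := ht.1.1.2.trans_le (min_le_right _ _)
  refine ⟨⟨ht.1.1.1, by linarith⟩, ht.2.1, ?_⟩
  by_contra hnC
  exact ht.2.2 (subset_toMeasurable _ _ ⟨ht.2.1, hnC⟩)

/-- If the gradient of a convex function is almost countable to one, it is almost injective. -/
theorem exists_injOn_of_countable_fibres [CompleteSpace E] (hg : ClosedConvexOn s g)
    (hG : MeasurableSet G) (hGfin : μ G ≠ ∞) (hF : ∀ x ∈ G, s ∈ 𝓝 x ∧ HasGradientAt g (F x) x) (hFm : Measurable F)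
    {C : Set E} (hC : μ (G \ C) = 0) (hfib : ∀ v, (C ∩ F ⁻¹' {v}).Countable) :
    ∃ N, μ N = 0 ∧ InjOn F (G \ N) := by
  obtain ⟨W, hWm, hWc, hWmin⟩ := exists_contractsAlong_isMinimalPreimage (μ := μ) hg hG hF hFm
  set P : Set E := G ∩ {x | W x = x}ᶜ with hP
  have hPm : MeasurableSet P := hG.inter (measurableSet_eq_fun hWm measurable_id).compl
  refine ⟨P, ?_, fun x hx x' hx' he => ?_⟩
  · by_contra hne
    obtain ⟨K, hKP, hK, hKpos⟩ := hPm.exists_lt_isCompact_of_ne_top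
      (measure_ne_top_of_subset inter_subset_left hGfin) (pos_iff_ne_zero.2 hne)
    have hKG : K ⊆ G := hKP.trans inter_subset_left
    obtain ⟨x, hxK, hx⟩ := hWc.exists_not_countable hWm hK hKG hKpos.ne'
      (measure_mono_null (sdiff_subset_sdiff_left hKG) hC)
    have hxW : W x ≠ x := (hKP hxK).2
    -- The times inject into one fibre of `F`: `F x` is a subgradient along the whole segment and
    -- must equal the gradient where there is one.
    refine hx (MapsTo.countable_of_injOn (f := fun t : ℝ => (1 - t) • x + t • W x)
      (t := C ∩ F ⁻¹' {F x}) (fun t ht => ⟨ht.2.2, ?_⟩) ?_ (hfib _))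
    · have h1 : IsSubgradientAt s g (F x) ((1 - t) • x + t • W x) :=
        ((hF x (hKG hxK)).2.isSubgradientAt hg.convexOn
          (mem_of_mem_nhds (hF x (hKG hxK)).1)).combo hg.convexOn (hWmin x (hKG hxK)).1
          (by linarith [ht.1.2]) ht.1.1.le (by ring)
      have h2 := hF _ (hKG ht.2.1)
      exact (h1.eq_of_hasGradientAt h2.1 h2.2).symm
    · intro t _ t' _ htt
      have h1 : (t - t') • (W x - x) = 0 := by
        have h2 : ((1 - t) • x + t • W x) - ((1 - t') • x + t' • W x) = 0 := sub_eq_zero.2 htt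
        rw [← h2]
        module
      rcases smul_eq_zero.1 h1 with h | h
      · exact sub_eq_zero.1 h
      · exact (hxW (sub_eq_zero.1 h)).elim
  · have hfix : ∀ z ∈ G \ P, W z = z := fun z hz => by
      by_contra h
      exact hz.2 ⟨hz.1, h⟩
    have h1 := hWmin x hx.1
    have h2 := hWmin x' hx'.1
    rw [he] at h1
    rw [← hfix x hx, ← hfix x' hx', h1.eq hg.convexOn h2]

end CountableFibres

/-! ### Images of measurable maps from a measure-interval. -/

section MeasureInterval

/-- The image of a measurable set under a measurable map from a measure-interval contains a
measurable set whose preimage is at least as large. -/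
theorem IsMeasureInterval.exists_measurableSet_subset_image {X : Type*} [MeasurableSpace X]
    {μ : Measure X} (hX : IsMeasureInterval μ) {E : Type*} [TopologicalSpace E] [PolishSpace E]
    [MeasurableSpace E] [BorelSpace E] {f : X → E} (hf : Measurable f) {U : Set X}
    (hU : MeasurableSet U) : ∃ C ⊆ f '' U, MeasurableSet C ∧ μ U ≤ μ (f ⁻¹' C) := by
  obtain ⟨hfin, hcomp, τ, hτ, X₀, Z₀, hX₀, hZ₀, hbij, himage⟩ := hX
  rcases eq_or_ne (μ U) 0 with hU0 | hU0
  · exact ⟨∅, empty_subset _, MeasurableSet.empty, by simp [hU0]⟩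
  have hne : Nonempty X := (nonempty_of_measure_ne_zero hU0).to_type
  set ρ := lebesgueOn (Icc (0 : ℝ) (μ.real univ)) with hρ
  have hρfin : IsFiniteMeasure ρ := by
    rw [← hτ.map_eq]
    infer_instance
  have hX₀m : MeasurableSet X₀ := (hcomp.out' _ hX₀).of_compl
  set σ := Function.invFunOn τ X₀ with hσ
  have hσl : LeftInvOn σ τ X₀ := hbij.injOn.leftInvOn_invFunOn
  have hpre : ∀ B : Set E, τ '' (X₀ ∩ f ⁻¹' B) =ᵐ[ρ] (fun z => f (σ z)) ⁻¹' B := by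
    intro B
    have : ∀ᵐ z ∂ρ, z ∈ Z₀ := hZ₀
    filter_upwards [this] with z hz
    obtain ⟨x, hx, rfl⟩ := hbij.surjOn hz
    refine propext ⟨?_, fun h => ⟨x, ⟨hx, ?_⟩, rfl⟩⟩
    · rintro ⟨x', hx', he⟩
      rw [hbij.injOn hx'.1 hx he] at hx'
      change f (σ (τ x)) ∈ B
      rw [hσl hx]
      exact hx'.2
    · have h : f (σ (τ x)) ∈ B := h
      rwa [hσl hx] at h
  have hmeasB : ∀ B : Set E, MeasurableSet B → MeasurableSet (X₀ ∩ f ⁻¹' B) := fun B hB =>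
    hX₀m.inter (hf hB)
  have hnull : NullMeasurable (fun z => f (σ z)) ρ := fun B hB =>
    (himage _ inter_subset_left (hmeasB B hB)).1.congr (hpre B)
  obtain ⟨h, hhm, hh⟩ := hnull.aemeasurable
  have hUX : MeasurableSet (U ∩ X₀) := hU.inter hX₀m
  obtain ⟨hUnull, hUmeas⟩ := himage _ inter_subset_right hUX
  have hgood : NullMeasurableSet (τ '' (U ∩ X₀) ∩ {z | f (σ z) = h z}) ρ :=
    hUnull.inter (NullMeasurableSet.of_compl
      (NullMeasurableSet.of_null (by simpa [compl_ofPred] using ae_iff.1 hh)))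
  obtain ⟨Z, hZsub, hZm, hZae⟩ := hgood.exists_measurable_subset_ae_eq
  have hZmeas : ρ Z = μ U := by
    rw [measure_congr hZae, measure_inter_conull (by simpa [compl_ofPred] using ae_iff.1 hh), hUmeas]
    exact measure_inter_conull hX₀
  -- The image of `Z` under the Borel map `h` need not be Borel. Inner regularity on the graph gives
  -- compact pieces, whose projections are compact.
  set γ := ρ.map fun z => (z, h z) with hγ
  have hgm : Measurable fun z => (z, h z) := measurable_id.prodMk hhm
  set Γ : Set (Icc (0 : ℝ) (μ.real univ) × E) := (Z ×ˢ univ) ∩ {q | h q.1 = q.2} with hΓ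
  have hΓm : MeasurableSet Γ := (hZm.prod MeasurableSet.univ).inter
    (measurableSet_eq_fun (hhm.comp measurable_fst) measurable_snd)
  have hΓmeas : γ Γ = μ U := by
    rw [hγ, Measure.map_apply hgm hΓm, ← hZmeas]
    congr 1
    ext z
    simp [hΓ]
  have hγfin : IsFiniteMeasure γ := by rw [hγ]; infer_instance
  have happrox : ∀ k : ℕ, ∃ K ⊆ Γ, IsCompact K ∧ γ Γ ≤ γ K + ENNReal.ofReal (1 / (k + 1)) := by
    intro k
    obtain ⟨K, hK, hKc, hlt⟩ := hΓm.exists_isCompact_lt_add (measure_ne_top γ Γ)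
      (ENNReal.ofReal_pos.2 (Nat.one_div_pos_of_nat (α := ℝ) (n := k))).ne'
    exact ⟨K, hK, hKc, hlt.le⟩
  choose K hKΓ hKc hKle using happrox
  set C : Set E := ⋃ k, Prod.snd '' K k with hC
  have hCm : MeasurableSet C := MeasurableSet.iUnion fun k =>
    ((hKc k).image continuous_snd).measurableSet
  refine ⟨C, ?_, hCm, ?_⟩
  · refine iUnion_subset fun k => ?_
    rintro _ ⟨q, hq, rfl⟩
    obtain ⟨⟨hqZ, -⟩, hqh⟩ := hKΓ k hq
    obtain ⟨⟨x, hx, hxq⟩, hzq⟩ := hZsub hqZ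
    refine ⟨x, hx.1, ?_⟩
    have h1 : f (σ q.1) = h q.1 := hzq
    have h2 : h q.1 = q.2 := hqh
    rw [← h2, ← h1, ← hxq, hσl hx.2]
  · have hCpre : μ (f ⁻¹' C) = ρ (h ⁻¹' C) := by
      have h1 : (fun z => f (σ z)) ⁻¹' C =ᵐ[ρ] h ⁻¹' C := hh.preimage C
      rw [← measure_congr ((hpre C).trans h1), (himage _ inter_subset_left (hmeasB C hCm)).2,
        inter_comm, measure_inter_conull hX₀]
    have hle : ∀ k : ℕ, μ U ≤ μ (f ⁻¹' C) + ENNReal.ofReal (1 / (k + 1)) := by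
      intro k
      rw [← hΓmeas]
      refine (hKle k).trans (add_le_add_left ?_ _)
      rw [hCpre, hγ, Measure.map_apply hgm (hKc k).measurableSet]
      exact measure_mono fun z hz => mem_iUnion.2 ⟨k, _, hz, rfl⟩
    have hlim : Tendsto (fun k : ℕ => μ (f ⁻¹' C) + ENNReal.ofReal (1 / (k + 1))) atTop
        (𝓝 (μ (f ⁻¹' C) + ENNReal.ofReal 0)) :=
      tendsto_const_nhds.add (ENNReal.tendsto_ofReal tendsto_one_div_add_atTop_nhds_zero_nat)
    rw [ENNReal.ofReal_zero, add_zero] at hlim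
    exact ge_of_tendsto' hlim hle

end MeasureInterval

/-! ### From extended-real potentials to closed convex functions. -/

section Potential

variable {n : ℕ} {ψ : EuclideanSpace ℝ (Fin n) → EReal}

theorem IsProperLscConvex.closedConvexOn (hψ : IsProperLscConvex ψ) :
    ClosedConvexOn {z | ψ z ≠ ⊤} fun z => (ψ z).toReal := by
  have hepi : {p : EuclideanSpace ℝ (Fin n) × ℝ | p.1 ∈ {z | ψ z ≠ ⊤} ∧ (ψ p.1).toReal ≤ p.2} =
      {p | ψ p.1 ≤ (p.2 : EReal)} := by
    ext p
    constructor
    · rintro ⟨h, hle⟩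
      change ψ p.1 ≤ (p.2 : EReal)
      rw [← EReal.coe_toReal h (hψ.ne_bot _)]
      exact EReal.coe_le_coe_iff.2 hle
    · intro h
      have h : ψ p.1 ≤ (p.2 : EReal) := h
      have ht : ψ p.1 ≠ ⊤ := ne_top_of_le_ne_top (EReal.coe_ne_top _) h
      refine ⟨ht, ?_⟩
      rwa [← EReal.coe_toReal ht (hψ.ne_bot _), EReal.coe_le_coe_iff] at h
  refine ⟨?_, ?_⟩
  · rw [convexOn_iff_convex_epigraph]
    exact hepi ▸ hψ.convex_epigraph
  · rw [hepi]
    exact hψ.lsc.isClosed_epigraph.preimage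
      (continuous_fst.prodMk (continuous_coe_real_ereal.comp continuous_snd))

theorem IsProperLscConvex.measurable_toReal (hψ : IsProperLscConvex ψ) :
    Measurable fun z => (ψ z).toReal :=
  measurable_ereal_toReal.comp hψ.lsc.measurable

theorem measurable_gradient {E : Type*} [NormedAddCommGroup E] [InnerProductSpace ℝ E]
    [CompleteSpace E] [MeasurableSpace E] [BorelSpace E] (f : E → ℝ) : Measurable (gradient f) :=
  (InnerProductSpace.toDual ℝ E).symm.continuous.measurable.comp (measurable_fderiv ℝ f)

end Potential

/-! ### Lebesgue measure on the subspace `Y`. -/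

section Subspace

variable {E : Type*} [MeasureSpace E] {Y : Set E}

theorem lebesgueOn_apply (hY : NullMeasurableSet Y volume) {t : Set Y}
    (ht : NullMeasurableSet t (lebesgueOn Y)) : lebesgueOn Y t = volume (Subtype.val '' t) :=
  Measure.comap_apply₀ _ _ Subtype.val_injective
    (fun _ => Measure.MeasurableSet.nullMeasurableSet_subtype_coe hY) ht

theorem lebesgueOn_preimage (hY : NullMeasurableSet Y volume) {A : Set E} (hA : MeasurableSet A) :
    lebesgueOn Y (Subtype.val ⁻¹' A) = volume (Y ∩ A) := by
  rw [lebesgueOn_apply hY (measurable_subtype_coe hA).nullMeasurableSet,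
    Subtype.image_preimage_coe]

theorem exists_measurableSet_of_ae_lebesgueOn (hY : NullMeasurableSet Y volume) {P : Y → Prop}
    (hP : ∀ᵐ y ∂lebesgueOn Y, P y) : ∃ Y' ⊆ Y, MeasurableSet Y' ∧ volume (Y \ Y') = 0 ∧
      ∀ y : Y, (y : E) ∈ Y' → P y := by
  have h0 : volume (Subtype.val '' {y : Y | ¬ P y}) = 0 :=
    Measure.measure_subtype_coe_eq_zero_of_comap_eq_zero hY (ae_iff.1 hP)
  obtain ⟨Y', hsub, hm, hae⟩ :=
    (hY.diff (NullMeasurableSet.of_null h0)).exists_measurable_subset_ae_eq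
  refine ⟨Y', hsub.trans sdiff_subset, hm, ?_, fun y hy => ?_⟩
  · refine (measure_congr ((ae_eq_refl Y).diff hae)).trans (measure_mono_null ?_ h0)
    rintro x ⟨hx, hx'⟩
    by_contra h
    exact hx' ⟨hx, h⟩
  · by_contra h
    exact (hsub hy).2 (mem_image_of_mem _ h)

end Subspace

/-- For values in `B` the level sets of the restriction are the full level sets. Hence the set of
remaining values depends only on the law, and is the same for `u` and `uSharp`. -/
theorem offLargeLevelSets_preimage {U V : Type*} [MeasurableSpace U] (μ : Measure U) (f : U → V)
    (B : Set V) : offLargeLevelSets μ f (f ⁻¹' B) = f ⁻¹' {b ∈ B | μ (f ⁻¹' {b}) = 0} := by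
  ext x
  change (f x ∈ B ∧ _) ↔ (f x ∈ B ∧ _)
  refine and_congr_right fun hx => ?_
  rw [inter_eq_right.2 (preimage_mono (singleton_subset_iff.2 hx))]

/-- Monotone rearrangements are unique: two of them are gradients of convex functions that agree on
a measurable subset of full measure. -/
theorem IsMonotoneRearrangement.exists_common_gradient {X : Type*} [MeasurableSpace X]
    {μ : Measure X} {n : ℕ} {u : X → EuclideanSpace ℝ (Fin n)} {Y : Set (EuclideanSpace ℝ (Fin n))}
    (hY : NullMeasurableSet Y volume) (hYfin : volume Y < ⊤) {v w : Y → EuclideanSpace ℝ (Fin n)}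
    (hv : IsMonotoneRearrangement μ u Y v) (hw : IsMonotoneRearrangement μ u Y w) :
    ∃ s g F Y', ClosedConvexOn s g ∧ Measurable F ∧ Y' ⊆ Y ∧ MeasurableSet Y' ∧
      volume (Y \ Y') = 0 ∧ (∀ x ∈ Y', s ∈ 𝓝 x ∧ HasGradientAt g (F x) x) ∧
      ∀ y : Y, (y : EuclideanSpace ℝ (Fin n)) ∈ Y' → v y = F y ∧ w y = F y := by
  obtain ⟨ψ, hψ, hvψ⟩ := hv.exists_potential
  obtain ⟨φ, hφ, hwφ⟩ := hw.exists_potential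
  obtain ⟨Y', hsub, hm, hnull, hgood⟩ := exists_measurableSet_of_ae_lebesgueOn hY (hvψ.and hwφ)
  -- The total `gradient` is Borel on the whole space, unlike the given representatives on `Y`.
  set F₁ := gradient fun z => (ψ z).toReal with hF₁
  set F₂ := gradient fun z => (φ z).toReal with hF₂
  have hm₁ : Measurable F₁ := measurable_gradient _
  have hm₂ : Measurable F₂ := measurable_gradient _
  have e₁ : ∀ y : Y, (y : EuclideanSpace ℝ (Fin n)) ∈ Y' → v y = F₁ y := fun y hy =>
    (hgood y hy).1.2.gradient.symm
  have e₂ : ∀ y : Y, (y : EuclideanSpace ℝ (Fin n)) ∈ Y' → w y = F₂ y := fun y hy =>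
    (hgood y hy).2.2.gradient.symm
  have g₁ : ∀ x ∈ Y', {z | ψ z ≠ ⊤} ∈ 𝓝 x ∧ HasGradientAt (fun z => (ψ z).toReal) (F₁ x) x :=
    fun x hx => by
      have := (hgood ⟨x, hsub hx⟩ hx).1
      rw [← e₁ ⟨x, hsub hx⟩ hx]
      exact ⟨mem_interior_iff_mem_nhds.1 this.1, this.2⟩
  have g₂ : ∀ x ∈ Y', {z | φ z ≠ ⊤} ∈ 𝓝 x ∧ HasGradientAt (fun z => (φ z).toReal) (F₂ x) x :=
    fun x hx => by
      have := (hgood ⟨x, hsub hx⟩ hx).2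
      rw [← e₂ ⟨x, hsub hx⟩ hx]
      exact ⟨mem_interior_iff_mem_nhds.1 this.1, this.2⟩
  have hfull : ∀ᵐ (y : Y) ∂lebesgueOn Y, (y : EuclideanSpace ℝ (Fin n)) ∈ Y' := by
    have h := lebesgueOn_preimage hY hm.compl
    exact ae_iff.2 (h.trans hnull)
  have hYY' : ∀ A : Set (EuclideanSpace ℝ (Fin n)), volume (Y ∩ A) = volume (Y' ∩ A) := by
    intro A
    refine le_antisymm ?_ (measure_mono (inter_subset_inter_left _ hsub))
    refine (measure_mono (t := (Y' ∩ A) ∪ (Y \ Y')) fun x hx => ?_).trans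
      ((measure_union_le _ _).trans (by rw [hnull, add_zero]))
    by_cases h : x ∈ Y'
    · exact Or.inl ⟨h, hx.2⟩
    · exact Or.inr ⟨hx.1, h⟩
  have law : ∀ (f : Y → EuclideanSpace ℝ (Fin n))
      (F : EuclideanSpace ℝ (Fin n) → EuclideanSpace ℝ (Fin n)), Measurable F →
      (∀ y : Y, (y : EuclideanSpace ℝ (Fin n)) ∈ Y' → f y = F y) →
      ∀ A, MeasurableSet A → volume (Y' ∩ F ⁻¹' A) = lebesgueOn Y (f ⁻¹' A) := by
    intro f F hF hf A hA
    rw [← hYY', ← lebesgueOn_preimage hY (hF hA)]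
    refine measure_congr ?_
    filter_upwards [hfull] with y hy
    refine propext ?_
    change F y ∈ A ↔ f y ∈ A
    rw [hf y hy]
  have hae := ae_eq_of_hasGradientAt_of_measure_preimage_eq (μ := volume) hψ.closedConvexOn
    hφ.closedConvexOn hψ.measurable_toReal hφ.measurable_toReal hm
    (measure_ne_top_of_subset hsub hYfin.ne) g₁ g₂ fun A hA => by
      rw [law v F₁ hm₁ e₁ A hA, law w F₂ hm₂ e₂ A hA,
        ← hv.isRearrangement.measure_preimage_eq A hA,
        ← hw.isRearrangement.measure_preimage_eq A hA]
  rw [ae_restrict_iff' hm, ae_iff] at hae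
  refine ⟨_, _, F₁, Y' ∩ {x | F₁ x = F₂ x}, hψ.closedConvexOn, hm₁,
    inter_subset_left.trans hsub, hm.inter (measurableSet_eq_fun hm₁ hm₂), ?_,
    fun x hx => g₁ x hx.1, fun y hy => ⟨e₁ y hy.1, (e₂ y hy.1).trans hy.2.symm⟩⟩
  refine measure_mono_null (t := (Y \ Y') ∪ {x | ¬ (x ∈ Y' → F₁ x = F₂ x)}) ?_
    (measure_union_null hnull hae)
  rintro x ⟨hx, hx'⟩
  by_cases h : x ∈ Y'
  · exact Or.inr fun h' => hx' ⟨h, h' h⟩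
  · exact Or.inl ⟨hx, h⟩

end PolarFactorisation

/-! ### Transfer of countable fibres through the factorisation. -/

open PolarFactorisation in
theorem theorem2 {n : ℕ} {X : Type*} [MeasurableSpace X] (μ : Measure X)
    (hX : PolarFactorisation.IsMeasureInterval μ)
    (Y : Set (EuclideanSpace ℝ (Fin n))) (hY : NullMeasurableSet Y volume)
    (hY_pos : 0 < volume Y) (hY_fin : volume Y < ⊤) (hXY : μ univ = volume Y)
    (u : X → EuclideanSpace ℝ (Fin n)) (hu : Integrable u μ)
    (uSharp : Y → EuclideanSpace ℝ (Fin n))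
    (huSharp : PolarFactorisation.IsMonotoneRearrangement μ u Y uSharp)
    (B : Set (EuclideanSpace ℝ (Fin n))) (hB : MeasurableSet B)
    (h_not_inj : ¬ PolarFactorisation.AlmostInjectiveOn (PolarFactorisation.lebesgueOn Y) uSharp
      (PolarFactorisation.offLargeLevelSets (PolarFactorisation.lebesgueOn Y) uSharp (uSharp ⁻¹' B)))
    (h_countable : PolarFactorisation.AlmostCountableToOneOn μ u
      (PolarFactorisation.offLargeLevelSets μ u (u ⁻¹' B))) :
    ¬ PolarFactorisation.HasPolarFactorisation μ u Y := by
  rintro ⟨v, hv, σ, hσ, huv⟩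
  obtain ⟨s, g, F, Y', hg, hFm, hsub, hY'm, hnull, hgrad, hvF⟩ :=
    hv.exists_common_gradient hY hY_fin huSharp
  apply h_not_inj
  have := hX.finite
  have := hX.complete
  have hlfin : IsFiniteMeasure (lebesgueOn Y) := by rw [← hσ.map_eq]; infer_instance
  have hrearr := huSharp.isRearrangement
  set D := {b ∈ B | lebesgueOn Y (uSharp ⁻¹' {b}) = 0} with hD
  have hDu : {b ∈ B | μ (u ⁻¹' {b}) = 0} = D := by
    simp only [hD, hrearr.measure_preimage_eq _ (measurableSet_singleton _)]
  have hDm : MeasurableSet D := by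
    -- Only countably many values have level sets of positive measure, so discarding them keeps `D`
    -- Borel.
    have hcount := Measure.countable_meas_level_set_pos₀ (μ := lebesgueOn Y) (g := uSharp)
      hrearr.integrable_right.aestronglyMeasurable.aemeasurable.nullMeasurable
    convert hB.diff hcount.measurableSet using 1
    ext b
    change (b ∈ B ∧ lebesgueOn Y (uSharp ⁻¹' {b}) = 0) ↔
      (b ∈ B ∧ ¬ 0 < lebesgueOn Y (uSharp ⁻¹' {b}))
    rw [pos_iff_ne_zero, not_not]
  rw [offLargeLevelSets_preimage, ← hD]
  rw [offLargeLevelSets_preimage, hDu] at h_countable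
  obtain ⟨U₀, hU₀, hU₀null, hfib⟩ := h_countable
  set f : X → EuclideanSpace ℝ (Fin n) := fun x => σ x with hf
  have hfm : Measurable f := measurable_subtype_coe.comp hσ.measurable
  have hfpre : ∀ A, MeasurableSet A → μ (f ⁻¹' A) = volume (Y ∩ A) := fun A hA => by
    rw [← lebesgueOn_preimage hY hA,
      ← hσ.measure_preimage (measurable_subtype_coe hA).nullMeasurableSet]
    rfl
  set U := U₀ ∩ ({x | u x = v (σ x)} ∩ f ⁻¹' Y') with hU
  have hTU : μ (u ⁻¹' D \ U) = 0 := by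
    refine measure_mono_null (t := (u ⁻¹' D \ U₀) ∪ ({x | ¬ u x = (v ∘ σ) x} ∪ f ⁻¹' Y'ᶜ)) ?_
      (measure_union_null hU₀null (measure_union_null (ae_iff.1 huv) ?_))
    · rintro x ⟨hx, hxU⟩
      by_contra h
      simp only [mem_union, not_or] at h
      exact hxU ⟨by_contra fun h' => h.1 ⟨hx, h'⟩, not_not.1 h.2.1, not_not.1 h.2.2⟩
    · exact (hfpre _ hY'm.compl).trans hnull
  have hUT : U ⊆ u ⁻¹' D := inter_subset_left.trans hU₀
  have hT : NullMeasurableSet (u ⁻¹' D) μ :=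
    hu.aestronglyMeasurable.aemeasurable.nullMeasurable hDm
  have hUae : U =ᵐ[μ] u ⁻¹' D := hUT.eventuallyLE.antisymm (ae_le_set.2 hTU)
  have hUm : MeasurableSet U := (hT.congr hUae.symm).measurable_of_complete
  obtain ⟨C, hCU, hCm, hCle⟩ := hX.exists_measurableSet_subset_image hfm hUm
  set G := Y' ∩ F ⁻¹' D with hG
  have hGm : MeasurableSet G := hY'm.inter (hFm hDm)
  have hGfin : volume G ≠ ∞ := measure_ne_top_of_subset (inter_subset_left.trans hsub) hY_fin.ne
  have hUf : ∀ x ∈ U, f x ∈ Y' ∧ F (f x) = u x := fun x hx =>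
    ⟨hx.2.2, (hvF (σ x) hx.2.2).1.symm.trans (Eq.symm hx.2.1)⟩
  have hCG : C ⊆ G := by
    intro y hy
    obtain ⟨x, hx, rfl⟩ := hCU hy
    refine ⟨(hUf x hx).1, ?_⟩
    change F (f x) ∈ D
    rw [(hUf x hx).2]
    exact hUT hx
  -- A count of mass: `G` is no larger than `uSharp ⁻¹' D`, which has the measure of `u ⁻¹' D`, that
  -- is of `U`, and `σ` carries this into `C`.
  have hGC : volume (G \ C) = 0 := by
    rw [measure_sdiff hCG hCm.nullMeasurableSet (measure_ne_top_of_subset hCG hGfin),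
      tsub_eq_zero_iff_le]
    calc volume G = volume (Y ∩ G) := by
          rw [inter_eq_right.2 (inter_subset_left.trans hsub : G ⊆ Y)]
      _ ≤ lebesgueOn Y (uSharp ⁻¹' D) := by
          rw [← lebesgueOn_preimage hY hGm]
          refine measure_mono fun y hy => ?_
          change uSharp y ∈ D
          rw [(hvF y hy.1).2]
          exact hy.2
      _ = μ U := by rw [← hrearr.measure_preimage_eq D hDm, measure_congr hUae]
      _ ≤ volume (Y ∩ C) := hCle.trans_eq (hfpre C hCm)
      _ ≤ volume C := measure_mono inter_subset_right
  have hCfib : ∀ b, (C ∩ F ⁻¹' {b}).Countable := fun b => by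
    refine ((hfib b).image f).mono ?_
    rintro y ⟨hyC, hyb⟩
    obtain ⟨x, hx, rfl⟩ := hCU hyC
    exact ⟨x, ⟨hx.1, (hUf x hx).2.symm.trans hyb⟩, rfl⟩
  obtain ⟨N, hN, hinj⟩ := exists_injOn_of_countable_fibres (μ := volume) hg hGm hGfin
    (fun x hx => hgrad x hx.1) hFm hGC hCfib
  refine ⟨uSharp ⁻¹' D ∩ Subtype.val ⁻¹' (G \ N), inter_subset_left, ?_, ?_⟩
  · refine measure_mono_null (t := Subtype.val ⁻¹' Y'ᶜ ∪ Subtype.val ⁻¹' toMeasurable volume N) ?_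
      (measure_union_null ((lebesgueOn_preimage hY hY'm.compl).trans hnull) ?_)
    · rintro y ⟨hyD, hy⟩
      by_contra h
      simp only [mem_union, not_or] at h
      have hyY' : (y : EuclideanSpace ℝ (Fin n)) ∈ Y' := not_not.1 h.1
      refine hy ⟨hyD, ⟨hyY', ?_⟩, fun hyN => h.2 (subset_toMeasurable _ _ hyN)⟩
      change F y ∈ D
      rw [← (hvF y hyY').2]
      exact hyD
    · rw [lebesgueOn_preimage hY (measurableSet_toMeasurable _ _)]
      exact measure_mono_null inter_subset_right ((measure_toMeasurable N).trans hN)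
  · intro y hy y' hy' he
    rw [(hvF y hy.2.1.1).2, (hvF y' hy'.2.1.1).2] at he
    exact Subtype.ext (hinj hy.2 hy'.2 he)
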